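/- Let $d \geq 2$ be an integer and $a \in (1-\frac d2, \frac12)$, and let $\sigma$ be the (unnormalised) surface measure on the unit sphere $\mathbb{S}^{d-1} \subset \mathbb{R}^d$. For $k \in \{0,1,2,\dots\}$ put $$\lambda_k = \frac{\pi^{\frac{d-1}{2}}}{2^{2a}}\,\frac{(-1)^k\,\Gamma(\frac12-a)\,\Gamma(2-a-\frac d2)}{\Gamma(2-a-\frac d2-k)\,\Gamma(-a+\frac d2+k)},$$ where, with $x = 2-a-\frac d2$, the quotient $\Gamma(x)/\Gamma(x-k)$ is understood as $(x-1)(x-2)\cdots(x-k)$; this agrees with the literal quotient unless $x \in \{0,-1,-2,\dots\}$, and in that case $\lambda_k$ is the limit of the displayed expression with $a$ replaced by $b$, as $b \to a$, $b \neq a$. For every $f \in L^2(\mathbb{S}^{d-1})$ (complex valued) the integral $$T_{\mathbb{S}} f(\omega) = \frac12 \int_{\mathbb{S}^{d-1}} \frac{1}{|\theta-\omega|^{d+2a-2}}\, f(\theta)\, \mathrm{d}\sigma(\theta)$$ converges absolutely for $\sigma$-almost every $\omega$, and it defines a bounded linear operator $T_{\mathbb{S}} : L^2(\mathbb{S}^{d-1})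 \to L^2(\mathbb{S}^{d-1})$, which is compact. If $k \geq 0$ and $P$ is a solid spherical harmonic of degree $k$ (a harmonic polynomial on $\mathbb{R}^d$ with complex coefficients, homogeneous of degree $k$), then $T_{\mathbb{S}} P = \lambda_k P$, both in $L^2(\mathbb{S}^{d-1})$ and at every point of $\mathbb{S}^{d-1}$, the integral converging absolutely there. The sequence $(\lambda_k)_{k \geq 0}$ is strictly decreasing and converges to $0$, and the operator norm of $T_{\mathbb{S}}$ on $L^2(\mathbb{S}^{d-1})$ equals $$\lambda_0 = \frac{\pi^{\frac{d-1}{2}}}{2^{2a}}\,\frac{\Gamma(\frac12-a)}{\Gamma(-a+\frac d2)}.$$ -/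

import Mathlib

open MeasureTheory Filter Topology

noncomputable section

/-- Euclidean space `ℝ^d`. -/
abbrev EucSp (d : ℕ) : Type := EuclideanSpace ℝ (Fin d)

/-- The unit sphere `𝕊^{d-1}` of `ℝ^d`, as a type. -/
abbrev USphere (d : ℕ) : Type := Metric.sphere (0 : EucSp d) 1

/-- The surface measure `σ` on `𝕊^{d-1}` induced by Lebesgue measure (not normalised). -/
def surfMeasure (d : ℕ) : Measure (USphere d) :=
  (volume : Measure (EucSp d)).toSphere

instance surfMeasure_finite (d : ℕ) : IsFiniteMeasure (surfMeasure d) := by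
  unfold surfMeasure; infer_instance

/-- The complex Hilbert space `L²(𝕊^{d-1}, σ)`. -/
abbrev L2Sphere (d : ℕ) : Type := Lp ℂ 2 (surfMeasure d)

/-- The integrand `θ ↦ |θ - ω|^{-(d+2a-2)} f(θ)`. -/
def rieszIntegrand (d : ℕ) (a : ℝ) (f : USphere d → ℂ) (ω θ : USphere d) : ℂ :=
  ((1 / ‖(θ : EucSp d) - (ω : EucSp d)‖ ^ ((d : ℝ) + 2 * a - 2) : ℝ) : ℂ) * f θ

/-- `T_𝕊 f(ω) = ½ ∫_{𝕊^{d-1}} |θ - ω|^{-(d+2a-2)} f(θ) dσ(θ)`. -/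
def rieszSphere (d : ℕ) (a : ℝ) (f : USphere d → ℂ) (ω : USphere d) : ℂ :=
  (1 / 2 : ℂ) * ∫ θ, rieszIntegrand d a f ω θ ∂(surfMeasure d)

/-- Solid spherical harmonics of degree `k`: polynomials on `ℝ^d` with complex coefficients
which are homogeneous of degree `k` and harmonic. -/
def IsSolidHarmonic (d k : ℕ) (P : MvPolynomial (Fin d) ℂ) : Prop :=
  P.IsHomogeneous k ∧ ∑ i : Fin d, MvPolynomial.pderiv i (MvPolynomial.pderiv i P) = 0

/-- The restriction to `𝕊^{d-1}` of the function on `ℝ^d` given by a polynomial. -/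
def sphereRestrict (d : ℕ) (P : MvPolynomial (Fin d) ℂ) : C(USphere d, ℂ) where
  toFun ω := MvPolynomial.eval (fun i => (((ω : EucSp d) i : ℝ) : ℂ)) P
  continuous_toFun := by
    refine (MvPolynomial.continuous_eval P).comp ?_
    fun_prop

/-- The Gamma function expression for `λ_k`. It is meaningful as it stands when `2 - a - d/2` is
not one of the poles `0, -1, -2, …` of `Γ`. -/
def eigenGamma (d : ℕ) (a : ℝ) (k : ℕ) : ℝ :=
  Real.pi ^ (((d : ℝ) - 1) / 2) / 2 ^ (2 * a) *
    (((-1) ^ k * Real.Gamma (1 / 2 - a) * Real.Gamma (2 - a - d / 2)) /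
      (Real.Gamma (2 - a - d / 2 - k) * Real.Gamma (-a + d / 2 + k)))

/-- The number `λ_k`, with the quotient `Γ(x) / Γ(x - k)`, `x = 2 - a - d/2`, read as
`(x - 1)(x - 2) ⋯ (x - k)`, which also gives it its value (the limit) at the poles of `Γ`. -/
def eigenVal (d : ℕ) (a : ℝ) (k : ℕ) : ℝ :=
  Real.pi ^ (((d : ℝ) - 1) / 2) / 2 ^ (2 * a) *
    (((-1) ^ k * Real.Gamma (1 / 2 - a) *
        ∏ j ∈ Finset.range k, (2 - a - (d : ℝ) / 2 - ((j : ℝ) + 1))) /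
      Real.Gamma (-a + d / 2 + k))

end

/-! Write `v = |θ - ω|² / 4 ∈ [0, 1]`. The kernel is `(4 v) ^ β` with `β = 1 - a - d/2`; the
condition `a < 1/2` says `β > -(d-1)/2`, which is integrability on a sphere of dimension `d - 1`,
and `a > 1 - d/2` says `β < 0`. Everything reduces to the moments `M(β) = ∫ v ^ β P dσ` of a
harmonic `P` of degree `k`.

The spherical Laplacian is symmetric and has `P` as an eigenfunction with eigenvalue `-k(k+d-2)`.
Applied to a power of `v` it yields the two-term recursion `chordMoment_recursion` between `M(β)`
and `M(β+1)`. Its derivation uses only that rotations preserve `σ`, and the singularity is handled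
by replacing `v` with `v + ε`. The same identity with `P = 1` bounds the integrals of `(v + ε) ^ β`
uniformly in `ε` and so gives integrability.

A recursion fixes `M` only up to a 1-periodic factor. For `P = 1` monotonicity in `β` removes it, as
in the Bohr-Mollerup theorem, and the total mass of `σ` fixes the scale. For general `P`, the
measures `v ^ n dσ`, once normalised, concentrate at the antipode `-ω`, so `M` is compared with the
moment of `1` at infinity. This gives the Funk-Hecke formula `chordMoment_eq` with the value `P(-ω)
= (-1)^k P(ω)`, hence the eigenvalues.

Schur's test gives boundedness with norm at most the common row integral of the kernel, which is
`λ_0` and is attained on constants. Compactness follows by approximating the kernel, in the Schur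
norm, by polynomials in `⟨ω, θ⟩`, which have finite rank. The ratio `λ_{k+1} / λ_k` is explicit and
lies in `(0, 1)`; it is so close to `1 - (1-2a)/k` that divergence of the harmonic series forces
`λ_k → 0`. -/

noncomputable section

/-! ### Rotation invariance and integration by parts on the sphere -/

/-- The action of a linear isometry on the unit sphere. -/
def sphereMap {d : ℕ} (e : EucSp d ≃ₗᵢ[ℝ] EucSp d) (θ : USphere d) : USphere d :=
  ⟨e θ, by simp⟩

lemma continuous_sphereMap {d : ℕ} (e : EucSp d ≃ₗᵢ[ℝ] EucSp d) : Continuous (sphereMap e) := by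
  unfold sphereMap
  fun_prop

-- The surface measure of `s` is `d` times the volume of the cone `(0, 1) • s`. A linear isometry
-- commutes with forming cones and preserves volume.
open scoped Pointwise in
lemma measurePreserving_sphereMap {d : ℕ} (e : EucSp d ≃ₗᵢ[ℝ] EucSp d) :
    MeasurePreserving (sphereMap e) (surfMeasure d) (surfMeasure d) := by
  refine ⟨(continuous_sphereMap e).measurable, ?_⟩
  ext s hs
  rw [Measure.map_apply (continuous_sphereMap e).measurable hs, surfMeasure,
    Measure.toSphere_apply' _ ((continuous_sphereMap e).measurable hs),
    Measure.toSphere_apply' _ hs]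
  congr 1
  have hm (S : Set (EucSp d)) : volume (e ⁻¹' S) = volume S :=
    e.measurePreserving.measure_preimage_equiv (f := e.toMeasurableEquiv) S
  rw [← hm (Set.Ioo (0 : ℝ) 1 • (Subtype.val '' s))]
  congr 1
  ext x
  simp only [Set.mem_smul, Set.mem_image, Set.mem_preimage, Subtype.exists, exists_and_right,
    exists_eq_right]
  constructor
  · rintro ⟨r, hr, y, ⟨hy, hys⟩, rfl⟩
    exact ⟨r, hr, e y, ⟨by simpa using hy, hys⟩, by simp⟩
  · rintro ⟨r, hr, y, ⟨hy, hys⟩, h⟩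
    refine ⟨r, hr, e.symm y, ⟨by simpa using hy, ?_⟩, ?_⟩
    · simpa [sphereMap] using hys
    · apply e.injective
      simpa using h

/-- The rotation `exp (τ B)` generated by a skew-adjoint map `B`. -/
def skewRotation {d : ℕ} {B : EucSp d →L[ℝ] EucSp d} (hB : B ∈ skewAdjoint (EucSp d →L[ℝ] EucSp d))
    (τ : ℝ) : EucSp d ≃ₗᵢ[ℝ] EucSp d :=
  Unitary.linearIsometryEquiv ⟨NormedSpace.exp (τ • B),
    letI := NormedAlgebra.restrictScalars ℚ ℝ (EucSp d →L[ℝ] EucSp d)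
    NormedSpace.exp_mem_unitary_of_mem_skewAdjoint (skewAdjoint.smul_mem τ hB)⟩

lemma skewRotation_apply {d : ℕ} {B : EucSp d →L[ℝ] EucSp d}
    (hB : B ∈ skewAdjoint (EucSp d →L[ℝ] EucSp d)) (τ : ℝ) (x : EucSp d) :
    skewRotation hB τ x = NormedSpace.exp (τ • B) x := rfl

lemma skewRotation_zero {d : ℕ} {B : EucSp d →L[ℝ] EucSp d}
    (hB : B ∈ skewAdjoint (EucSp d →L[ℝ] EucSp d)) (x : EucSp d) :
    skewRotation hB 0 x = x := by
  have h : (0 : ℝ) • B = 0 := zero_smul ℝ B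
  rw [skewRotation_apply, h, NormedSpace.exp_zero, one_apply_eq_self]

lemma hasDerivAt_skewRotation {d : ℕ} {B : EucSp d →L[ℝ] EucSp d}
    (hB : B ∈ skewAdjoint (EucSp d →L[ℝ] EucSp d)) (x : EucSp d) (τ : ℝ) (l : Fin d) :
    HasDerivAt (fun τ => skewRotation hB τ x l) (B (skewRotation hB τ x) l) τ := by
  have h := hasDerivAt_exp_smul_const' (𝕂 := ℝ) B τ
  have h2 := h.clm_apply (hasDerivAt_const τ x)
  have h3 := (EuclideanSpace.proj (𝕜 := ℝ) l).hasFDerivAt.comp_hasDerivAt τ h2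
  simpa [Function.comp_def, skewRotation_apply] using h3

/-- The integral over the sphere of the derivative of a function along a rotation field
vanishes. -/
lemma integral_rotation_deriv_eq_zero {d : ℕ} {B : EucSp d →L[ℝ] EucSp d}
    (hB : B ∈ skewAdjoint (EucSp d →L[ℝ] EucSp d)) {F D : USphere d → ℂ}
    (hF : Continuous F) (hD : Continuous D)
    (h : ∀ θ τ, HasDerivAt (fun τ => F (sphereMap (skewRotation hB τ) θ))
      (D (sphereMap (skewRotation hB τ) θ)) τ) :
    ∫ θ, D θ ∂(surfMeasure d) = 0 := by
  obtain ⟨M, hM⟩ := (isCompact_range hD).isBounded.exists_norm_le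
  have key := hasDerivAt_integral_of_dominated_loc_of_deriv_le (μ := surfMeasure d)
    (F := fun τ θ => F (sphereMap (skewRotation hB τ) θ))
    (F' := fun τ θ => D (sphereMap (skewRotation hB τ) θ)) (x₀ := (0 : ℝ)) (s := Set.univ)
    (bound := fun _ => M) univ_mem
    (Eventually.of_forall fun τ =>
      (hF.comp (continuous_sphereMap _)).aestronglyMeasurable)
    ((hF.comp (continuous_sphereMap _)).integrable_of_hasCompactSupport
      (HasCompactSupport.of_compactSpace _))
    (hD.comp (continuous_sphereMap _)).aestronglyMeasurable
    (Eventually.of_forall fun θ τ _ => hM _ ⟨_, rfl⟩) (integrable_const _)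
    (Eventually.of_forall fun θ τ _ => h θ τ)
  -- By invariance the integral of the rotated function does not depend on `τ`, so its derivative at
  -- `0`, which is the integral of `D`, vanishes.
  have hconst : (fun τ => ∫ θ, F (sphereMap (skewRotation hB τ) θ) ∂(surfMeasure d)) =
      fun _ => ∫ θ, F θ ∂(surfMeasure d) := by
    ext τ
    have hmp := measurePreserving_sphereMap (skewRotation hB τ)
    conv_rhs => rw [← hmp.map_eq]
    rw [integral_map hmp.aemeasurable hF.aestronglyMeasurable]
  have h0 := key.2
  rw [hconst] at h0
  have h1 := h0.unique (hasDerivAt_const _ _)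
  have h2 : ∀ θ, sphereMap (skewRotation hB 0) θ = θ := fun θ =>
    Subtype.ext (skewRotation_zero hB _)
  simpa [h2] using h1

/-- The generator `x ↦ x_i e_j - x_j e_i` of the rotations in a coordinate plane. -/
def planeGen {d : ℕ} (i j : Fin d) : EucSp d →L[ℝ] EucSp d :=
  (EuclideanSpace.proj (𝕜 := ℝ) i).smulRight (EuclideanSpace.single j (1 : ℝ)) -
    (EuclideanSpace.proj (𝕜 := ℝ) j).smulRight (EuclideanSpace.single i (1 : ℝ))

lemma planeGen_apply {d : ℕ} (i j l : Fin d) (x : EucSp d) :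
    planeGen i j x l = (if l = j then x i else 0) - (if l = i then x j else 0) := by
  simp [planeGen]

lemma planeGen_mem_skewAdjoint {d : ℕ} (i j : Fin d) :
    planeGen i j ∈ skewAdjoint (EucSp d →L[ℝ] EucSp d) := by
  rw [skewAdjoint.mem_iff, ContinuousLinearMap.star_eq_adjoint, eq_comm,
    ContinuousLinearMap.eq_adjoint_iff]
  intro x y
  simp [planeGen, inner_sub_left, inner_sub_right, inner_smul_left, inner_smul_right,
    EuclideanSpace.inner_single_left, EuclideanSpace.inner_single_right]
  ring

/-! ### Rotational derivatives of polynomials -/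

/-- The evaluation of a complex polynomial at a real point. -/
def polyEval {d : ℕ} (P : MvPolynomial (Fin d) ℂ) (x : EucSp d) : ℂ :=
  MvPolynomial.eval (fun i => ((x i : ℝ) : ℂ)) P

lemma hasDerivAt_polyEval {d : ℕ} (P : MvPolynomial (Fin d) ℂ) {γ : ℝ → EucSp d} {γ' : EucSp d}
    {τ : ℝ} (h : ∀ l, HasDerivAt (fun τ => γ τ l) (γ' l) τ) :
    HasDerivAt (fun τ => polyEval P (γ τ))
      (∑ l, (γ' l : ℂ) * polyEval (MvPolynomial.pderiv l P) (γ τ)) τ := by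
  induction P using MvPolynomial.induction_on with
  | C a => simpa [polyEval] using hasDerivAt_const τ a
  | add p q hp hq =>
    simp only [polyEval, map_add, mul_add, Finset.sum_add_distrib] at hp hq ⊢
    exact hp.add hq
  | mul_X p n hp =>
    have h1 := hp.mul (h n).ofReal_comp
    simp only [polyEval, map_mul, MvPolynomial.eval_X, Derivation.leibniz, smul_eq_mul, map_add,
      MvPolynomial.pderiv_X, Pi.single_apply] at h1 ⊢
    refine h1.congr_deriv ?_
    simp only [mul_add, Finset.sum_add_distrib, Finset.sum_mul]
    rw [add_comm]
    congr 1
    · rw [Finset.sum_eq_single n]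
      · simp; ring
      · intro b _ hb; simp [hb.symm]
      · simp
    · refine Finset.sum_congr rfl fun l _ => by ring

/-- The derivative of a polynomial along `x_i ∂_j - x_j ∂_i`. -/
def rotDeriv {d : ℕ} (i j : Fin d) (P : MvPolynomial (Fin d) ℂ) : MvPolynomial (Fin d) ℂ :=
  MvPolynomial.X i * MvPolynomial.pderiv j P - MvPolynomial.X j * MvPolynomial.pderiv i P

lemma hasDerivAt_polyEval_skewRotation {d : ℕ} (P : MvPolynomial (Fin d) ℂ) (i j : Fin d)
    (x : EucSp d) (τ : ℝ) :
    HasDerivAt (fun τ => polyEval P (skewRotation (planeGen_mem_skewAdjoint i j) τ x))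
      (polyEval (rotDeriv i j P) (skewRotation (planeGen_mem_skewAdjoint i j) τ x)) τ := by
  refine (hasDerivAt_polyEval P (hasDerivAt_skewRotation (planeGen_mem_skewAdjoint i j) x
    τ)).congr_deriv ?_
  simp only [planeGen_apply, Complex.ofReal_sub, sub_mul, Finset.sum_sub_distrib]
  simp [rotDeriv, polyEval, apply_ite ((↑) : ℝ → ℂ)]

/-- On the sphere the sum of the squares of all `x_i ∂_j - x_j ∂_i` is twice the spherical
Laplacian, since each plane is counted as `(i, j)` and as `(j, i)`. Expanding it leaves the flat
Laplacian, which kills `P`, and Euler operators, which act on `P` through its degree. -/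
lemma sum_rotDeriv_rotDeriv {d k : ℕ} {P : MvPolynomial (Fin d) ℂ} (hP : IsSolidHarmonic d k P) :
    ∑ i, ∑ j, rotDeriv i j (rotDeriv i j P) =
      MvPolynomial.C (-2 * (k : ℂ) * (k + d - 2)) * P := by
  obtain ⟨hh, hl⟩ := hP
  have hE := hh.sum_X_mul_pderiv
  -- The second-order Euler identity, obtained by applying the Euler operator twice.
  have hE2 : ∑ i, ∑ j, MvPolynomial.X i * MvPolynomial.X j *
      MvPolynomial.pderiv i (MvPolynomial.pderiv j P) =
        (k : MvPolynomial (Fin d) ℂ) * k * P - k * P := by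
    have h1 : ∀ i, MvPolynomial.X i * MvPolynomial.pderiv i (∑ j, MvPolynomial.X j *
        MvPolynomial.pderiv j P) = MvPolynomial.X i * MvPolynomial.pderiv i P +
          ∑ j, MvPolynomial.X i * MvPolynomial.X j *
      MvPolynomial.pderiv i (MvPolynomial.pderiv j P) := by
      intro i
      simp [MvPolynomial.pderiv_X, Pi.single_apply, Finset.sum_add_distrib,
        Finset.mul_sum, mul_add, mul_assoc, add_comm]
    have h2 : ∑ i, MvPolynomial.X i * MvPolynomial.pderiv i (∑ j, MvPolynomial.X j *
        MvPolynomial.pderiv j P) = (k : MvPolynomial (Fin d) ℂ) * k * P := by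
      rw [hE]
      simp only [map_nsmul, mul_smul_comm, ← Finset.smul_sum, hE]
      simp [mul_assoc]
    rw [← h2, Finset.sum_congr rfl fun i _ => h1 i, Finset.sum_add_distrib, hE]
    simp
  have hij : ∀ i j, rotDeriv i j (rotDeriv i j P) =
      MvPolynomial.X i ^ 2 * MvPolynomial.pderiv j (MvPolynomial.pderiv j P)
      + MvPolynomial.X j ^ 2 * MvPolynomial.pderiv i (MvPolynomial.pderiv i P)
      + (if i = j then 2 * (MvPolynomial.X i * MvPolynomial.pderiv i P) else 0)
      - MvPolynomial.X i * MvPolynomial.pderiv i P - MvPolynomial.X j * MvPolynomial.pderiv j P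
      - MvPolynomial.X i * MvPolynomial.X j * MvPolynomial.pderiv i (MvPolynomial.pderiv j P)
      - MvPolynomial.X j * MvPolynomial.X i * MvPolynomial.pderiv j (MvPolynomial.pderiv i P) := by
    intro i j
    by_cases h : i = j
    · subst h
      simp [rotDeriv]
      ring
    · have h' : j ≠ i := fun e => h e.symm
      simp [rotDeriv, MvPolynomial.pderiv_X, h, h']
      ring
  simp only [hij, Finset.sum_add_distrib, Finset.sum_sub_distrib]
  have e1 : ∑ i : Fin d, ∑ j : Fin d, MvPolynomial.X i ^ 2 *
      MvPolynomial.pderiv j (MvPolynomial.pderiv j P) = 0 := by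
    simp [← Finset.mul_sum, hl]
  have e2 : ∑ i : Fin d, ∑ j : Fin d, MvPolynomial.X j ^ 2 *
      MvPolynomial.pderiv i (MvPolynomial.pderiv i P) = 0 := by
    rw [Finset.sum_comm]; exact e1
  have e3 : ∑ i : Fin d, ∑ j : Fin d, MvPolynomial.X j * MvPolynomial.X i *
      MvPolynomial.pderiv j (MvPolynomial.pderiv i P) =
        (k : MvPolynomial (Fin d) ℂ) * k * P - k * P := by
    rw [Finset.sum_comm]; exact hE2
  rw [e1, e2, e3, hE2]
  have e4 : ∑ i : Fin d, ∑ _j : Fin d, MvPolynomial.X i * MvPolynomial.pderiv i P =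
      (d : MvPolynomial (Fin d) ℂ) * (k * P) := by
    simp [Finset.sum_const, ← Finset.mul_sum, hE]
  have e5 : ∑ _i : Fin d, ∑ j : Fin d, MvPolynomial.X j * MvPolynomial.pderiv j P =
      (d : MvPolynomial (Fin d) ℂ) * (k * P) := by
    rw [Finset.sum_comm]; exact e4
  rw [e4, e5]
  simp only [Finset.sum_ite_eq, Finset.mem_univ, if_true, ← Finset.mul_sum, hE]
  have hC : (MvPolynomial.C (2 : ℂ) : MvPolynomial (Fin d) ℂ) = 2 := map_ofNat _ 2
  simp [hC]
  ring

/-! ### Green's identity for zonal functions -/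

/-- The cosine of the angle between two points of the sphere. -/
def sphereCos {d : ℕ} (ω θ : USphere d) : ℝ := inner ℝ (ω : EucSp d) (θ : EucSp d)

lemma sphereCos_eq_sum {d : ℕ} (ω θ : USphere d) :
    sphereCos ω θ = ∑ l, (ω : EucSp d) l * (θ : EucSp d) l := by
  simp [sphereCos, PiLp.inner_apply, mul_comm]

lemma sphereCos_mem_Icc {d : ℕ} (ω θ : USphere d) : sphereCos ω θ ∈ Set.Icc (-1 : ℝ) 1 := by
  have h := abs_real_inner_le_norm (ω : EucSp d) (θ : EucSp d)
  simp only [norm_eq_of_mem_sphere, mul_one] at h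
  exact abs_le.1 h

lemma continuous_sphereCos {d : ℕ} (ω : USphere d) : Continuous (sphereCos ω) := by
  unfold sphereCos
  fun_prop

lemma sum_sq_coord {d : ℕ} (ω : USphere d) : ∑ l, (ω : EucSp d) l ^ 2 = 1 := by
  have h := EuclideanSpace.real_norm_sq_eq (ω : EucSp d)
  rw [norm_eq_of_mem_sphere] at h
  linarith

lemma sphereRestrict_eq_polyEval {d : ℕ} (P : MvPolynomial (Fin d) ℂ) (θ : USphere d) :
    sphereRestrict d P θ = polyEval P (θ : EucSp d) := rfl

/-- Green's identity on the sphere for a zonal function and a spherical harmonic. -/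
lemma integral_zonal_laplacian_mul {d k : ℕ} {P : MvPolynomial (Fin d) ℂ}
    (hP : IsSolidHarmonic d k P) (ω : USphere d) {g g₁ g₂ : ℝ → ℝ}
    (h0 : ∀ t ∈ Set.Icc (-1 : ℝ) 1, HasDerivAt g (g₁ t) t)
    (h1 : ∀ t ∈ Set.Icc (-1 : ℝ) 1, HasDerivAt g₁ (g₂ t) t)
    (h2 : ContinuousOn g₂ (Set.Icc (-1 : ℝ) 1)) :
    ∫ θ, (((1 - sphereCos ω θ ^ 2) * g₂ (sphereCos ω θ)
        - ((d : ℝ) - 1) * sphereCos ω θ * g₁ (sphereCos ω θ)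
        + (k : ℝ) * (k + d - 2) * g (sphereCos ω θ) : ℝ) : ℂ) * sphereRestrict d P θ
      ∂(surfMeasure d) = 0 := by
  have c0 : ContinuousOn g (Set.Icc (-1 : ℝ) 1) := fun t ht =>
    (h0 t ht).continuousAt.continuousWithinAt
  have c1 : ContinuousOn g₁ (Set.Icc (-1 : ℝ) 1) := fun t ht =>
    (h1 t ht).continuousAt.continuousWithinAt
  have cc {f : ℝ → ℝ} (hf : ContinuousOn f (Set.Icc (-1 : ℝ) 1)) :
      Continuous fun θ => ((f (sphereCos ω θ) : ℝ) : ℂ) :=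
    Complex.continuous_ofReal.comp
      (hf.comp_continuous (continuous_sphereCos ω) (sphereCos_mem_Icc ω))
  -- With `L = x_i ∂_j - x_j ∂_i`, these are `A = L⟨ω, x⟩` and `A' = L²⟨ω, x⟩`.
  let A (i j : Fin d) (x : EucSp d) : ℝ := x i * (ω : EucSp d) j - x j * (ω : EucSp d) i
  let A' (i j : Fin d) (x : EucSp d) : ℝ :=
    ((if i = j then x i else 0) - x j) * (ω : EucSp d) j -
      (x i - (if i = j then x j else 0)) * (ω : EucSp d) i
  have hA (i j : Fin d) : Continuous fun θ : USphere d => ((A i j θ : ℝ) : ℂ) := by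
    simp only [A]; fun_prop
  have hA' (i j : Fin d) : Continuous fun θ : USphere d => ((A' i j θ : ℝ) : ℂ) := by
    simp only [A']
    split_ifs <;> fun_prop
  -- `F = (L g) P - g (L P)`, with `g` evaluated at `⟨ω, θ⟩`. In `L F` the cross terms `(L g)(L P)`
  -- cancel, leaving `D = (L² g) P - g (L² P)`.
  let F (i j : Fin d) (θ : USphere d) : ℂ :=
    (g₁ (sphereCos ω θ) : ℂ) * (A i j θ : ℂ) * polyEval P (θ : EucSp d)
      - (g (sphereCos ω θ) : ℂ) * polyEval (rotDeriv i j P) (θ : EucSp d)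
  let D (i j : Fin d) (θ : USphere d) : ℂ :=
    (g₂ (sphereCos ω θ) : ℂ) * (A i j θ : ℂ) ^ 2 * polyEval P (θ : EucSp d)
      + (g₁ (sphereCos ω θ) : ℂ) * (A' i j θ : ℂ) * polyEval P (θ : EucSp d)
      - (g (sphereCos ω θ) : ℂ) * polyEval (rotDeriv i j (rotDeriv i j P)) (θ : EucSp d)
  have hp (Q : MvPolynomial (Fin d) ℂ) : Continuous fun θ : USphere d => polyEval Q (θ : EucSp d) :=
    (sphereRestrict d Q).continuous
  have hF (i j : Fin d) : Continuous (F i j) :=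
    (((cc c1).mul (hA i j)).mul (hp _)).sub ((cc c0).mul (hp _))
  have hD (i j : Fin d) : Continuous (D i j) :=
    ((((cc h2).mul ((hA i j).pow 2)).mul (hp _)).add (((cc c1).mul (hA' i j)).mul (hp _))).sub
      ((cc c0).mul (hp _))
  have hder (i j : Fin d) : ∫ θ, D i j θ ∂(surfMeasure d) = 0 := by
    refine integral_rotation_deriv_eq_zero (planeGen_mem_skewAdjoint i j) (hF i j) (hD i j) ?_
    intro θ τ
    have hx (l : Fin d) := hasDerivAt_skewRotation (planeGen_mem_skewAdjoint i j) (θ : EucSp d) τ l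
    have hP0 := hasDerivAt_polyEval_skewRotation P i j (θ : EucSp d) τ
    have hP1 := hasDerivAt_polyEval_skewRotation (rotDeriv i j P) i j (θ : EucSp d) τ
    set γ := fun τ => sphereMap (skewRotation (planeGen_mem_skewAdjoint i j) τ) θ with hγ
    have ht : HasDerivAt (fun τ => sphereCos ω (γ τ)) (A i j (γ τ)) τ := by
      simp only [sphereCos_eq_sum]
      refine (HasDerivAt.fun_sum fun l _ => (hx l).const_mul ((ω : EucSp d) l)).congr_deriv ?_
      simp only [planeGen_apply, mul_sub, Finset.sum_sub_distrib, mul_ite, mul_zero,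
        Finset.sum_ite_eq', Finset.mem_univ, if_true, A, γ, sphereMap]
      ring
    have hAd : HasDerivAt (fun τ => A i j (γ τ)) (A' i j (γ τ)) τ := by
      refine (((hx i).mul_const _).sub ((hx j).mul_const _)).congr_deriv ?_
      simp only [planeGen_apply, A', γ, sphereMap, if_true, eq_comm (a := j) (b := i)]
    have hg := ((h0 _ (sphereCos_mem_Icc ω (γ τ))).comp τ ht).ofReal_comp
    have hg1 := ((h1 _ (sphereCos_mem_Icc ω (γ τ))).comp τ ht).ofReal_comp
    refine (((hg1.mul hAd.ofReal_comp).mul hP0).sub (hg.mul hP1)).congr_deriv ?_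
    simp only [D, γ, sphereMap, Function.comp_apply, Complex.ofReal_mul, Pi.mul_apply]
    ring
  have hsum : ∫ θ, ∑ i, ∑ j, D i j θ ∂(surfMeasure d) = 0 := by
    have hint (i j : Fin d) : Integrable (D i j) (surfMeasure d) :=
      (hD i j).integrable_of_hasCompactSupport (HasCompactSupport.of_compactSpace _)
    rw [integral_finsetSum _ fun i _ => integrable_finsetSum _ fun j _ => hint i j]
    refine Finset.sum_eq_zero fun i _ => ?_
    rw [integral_finsetSum _ fun j _ => hint i j]
    exact Finset.sum_eq_zero fun j _ => hder i j
  have hpt (θ : USphere d) : ∑ i, ∑ j, D i j θ = 2 * ((((1 - sphereCos ω θ ^ 2) * g₂ (sphereCos ω θ)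
        - ((d : ℝ) - 1) * sphereCos ω θ * g₁ (sphereCos ω θ)
        + (k : ℝ) * (k + d - 2) * g (sphereCos ω θ) : ℝ) : ℂ) * sphereRestrict d P θ) := by
    have s1 : ∑ i, ∑ j, A i j θ ^ 2 = 2 * (1 - sphereCos ω θ ^ 2) := by
      have e (i j : Fin d) : A i j θ ^ 2 = (θ : EucSp d) i ^ 2 * (ω : EucSp d) j ^ 2
          + (ω : EucSp d) i ^ 2 * (θ : EucSp d) j ^ 2
          - 2 * (((ω : EucSp d) i * (θ : EucSp d) i) * ((ω : EucSp d) j * (θ : EucSp d) j)) := by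
        simp only [A]; ring
      simp only [e, Finset.sum_sub_distrib, Finset.sum_add_distrib, ← Finset.mul_sum,
        ← Finset.sum_mul, sum_sq_coord, ← sphereCos_eq_sum]
      ring
    have s2 : ∑ i, ∑ j, A' i j θ = -2 * ((d : ℝ) - 1) * sphereCos ω θ := by
      have e (i j : Fin d) : A' i j θ =
          (if i = j then 2 * ((ω : EucSp d) i * (θ : EucSp d) i) else 0)
          - (ω : EucSp d) i * (θ : EucSp d) i - (ω : EucSp d) j * (θ : EucSp d) j := by
        by_cases h : i = j
        · subst h; simp [A']; ring
        · simp [A', h]; ring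
      have e' : ∑ i : Fin d, ∑ _j : Fin d, (ω : EucSp d) i * (θ : EucSp d) i =
          d * sphereCos ω θ := by
        simp [sphereCos_eq_sum, Finset.mul_sum]
      simp only [e, Finset.sum_sub_distrib, Finset.sum_ite_eq, Finset.mem_univ, if_true, e']
      simp only [← Finset.mul_sum, ← sphereCos_eq_sum]
      simp
      ring
    have s3 : ∑ i, ∑ j, polyEval (rotDeriv i j (rotDeriv i j P)) (θ : EucSp d) =
        -2 * (k : ℂ) * (k + d - 2) * polyEval P (θ : EucSp d) := by
      have := congrArg (fun Q => polyEval Q (θ : EucSp d)) (sum_rotDeriv_rotDeriv hP)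
      simpa [polyEval] using this
    have s1' := congrArg (fun r : ℝ => (r : ℂ)) s1
    have s2' := congrArg (fun r : ℝ => (r : ℂ)) s2
    push_cast at s1' s2'
    simp only [D, Finset.sum_sub_distrib, Finset.sum_add_distrib, ← Finset.mul_sum,
      ← Finset.sum_mul, s3, s1', s2', sphereRestrict_eq_polyEval]
    push_cast
    ring
  simp only [hpt, integral_const_mul] at hsum
  simpa using hsum

/-! ### Regularised powers of the distance and integrability -/

/-- A quarter of the squared distance between two points of the sphere. -/
def chordSq {d : ℕ} (ω θ : USphere d) : ℝ := (1 - sphereCos ω θ) / 2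

lemma chordSq_nonneg {d : ℕ} (ω θ : USphere d) : 0 ≤ chordSq ω θ := by
  have := (sphereCos_mem_Icc ω θ).2
  unfold chordSq; linarith

lemma chordSq_le_one {d : ℕ} (ω θ : USphere d) : chordSq ω θ ≤ 1 := by
  have := (sphereCos_mem_Icc ω θ).1
  unfold chordSq; linarith

lemma chordSq_comm {d : ℕ} (ω θ : USphere d) : chordSq ω θ = chordSq θ ω := by
  simp [chordSq, sphereCos, real_inner_comm]

lemma continuous_chordSq_uncurry {d : ℕ} :
    Continuous fun p : USphere d × USphere d => chordSq p.1 p.2 := by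
  unfold chordSq sphereCos
  fun_prop

lemma continuous_chordSq {d : ℕ} (ω : USphere d) : Continuous (chordSq ω) :=
  continuous_chordSq_uncurry.comp (Continuous.prodMk_right ω)

lemma norm_sub_sq_eq_chordSq {d : ℕ} (ω θ : USphere d) :
    ‖(θ : EucSp d) - (ω : EucSp d)‖ ^ 2 = 4 * chordSq ω θ := by
  rw [norm_sub_sq_real, norm_eq_of_mem_sphere, norm_eq_of_mem_sphere, real_inner_comm]
  simp only [chordSq, sphereCos]
  ring

lemma chordSq_eq_zero_iff {d : ℕ} {ω θ : USphere d} : chordSq ω θ = 0 ↔ θ = ω := by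
  have h := norm_sub_sq_eq_chordSq ω θ
  rw [Subtype.ext_iff, ← sub_eq_zero (a := (θ : EucSp d)), ← norm_eq_zero (a := _ - _),
    ← sq_eq_zero_iff (a := ‖_‖), h]
  simp

lemma chordSq_neg {d : ℕ} (ω θ : USphere d) : chordSq (-ω) θ = 1 - chordSq ω θ := by
  simp [chordSq, sphereCos]
  ring

/-- The regularised form of the recursion for the moments of a spherical harmonic. -/
lemma integral_regularized_eq_zero {d k : ℕ} {P : MvPolynomial (Fin d) ℂ}
    (hP : IsSolidHarmonic d k P) (ω : USphere d) (β : ℝ) {ε : ℝ} (hε : 0 < ε) :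
    ∫ θ, (((β + 1) * (β * (chordSq ω θ * (1 - chordSq ω θ)) * (chordSq ω θ + ε) ^ (β - 1)
        + ((d : ℝ) - 1) / 2 * (1 - 2 * chordSq ω θ) * (chordSq ω θ + ε) ^ β)
        + (k : ℝ) * (k + d - 2) * (chordSq ω θ + ε) ^ (β + 1) : ℝ) : ℂ) * sphereRestrict d P θ
      ∂(surfMeasure d) = 0 := by
  have hw : ∀ t ∈ Set.Icc (-1 : ℝ) 1, 0 < (1 - t) / 2 + ε := fun t ht => by
    have := ht.2; linarith
  have hd (t : ℝ) : HasDerivAt (fun t : ℝ => (1 - t) / 2 + ε) (-1 / 2) t :=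
    (((hasDerivAt_id t).const_sub 1).div_const 2).add_const ε
  -- Here `t = 1 - 2v` and `1 - t² = 4v(1 - v)`; the shift by `ε` makes the power smooth on all of
  -- `[-1, 1]`.
  have h := integral_zonal_laplacian_mul hP ω
    (g := fun t => ((1 - t) / 2 + ε) ^ (β + 1))
    (g₁ := fun t => -((β + 1) / 2) * ((1 - t) / 2 + ε) ^ β)
    (g₂ := fun t => (β + 1) * β / 4 * ((1 - t) / 2 + ε) ^ (β - 1))
    (fun t ht => ((hd t).rpow_const (p := β + 1) (Or.inl (hw t ht).ne')).congr_deriv (by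
      rw [add_sub_cancel_right]; ring))
    (fun t ht => (((hd t).rpow_const (p := β) (Or.inl (hw t ht).ne')).const_mul _).congr_deriv (by
      ring))
    (fun t ht => (((hd t).rpow_const (p := β - 1) (Or.inl (hw t ht).ne')).const_mul _
      ).continuousAt.continuousWithinAt)
  rw [← h]
  refine integral_congr_ae (Eventually.of_forall fun θ => ?_)
  simp only [← chordSq.eq_1]
  congr 2
  have hc : sphereCos ω θ = 1 - 2 * chordSq ω θ := by unfold chordSq; ring
  rw [hc]
  ring

lemma isSolidHarmonic_one (d : ℕ) : IsSolidHarmonic d 0 1 := by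
  refine ⟨MvPolynomial.isHomogeneous_one _ _, by simp⟩

lemma sphereRestrict_one {d : ℕ} (θ : USphere d) : sphereRestrict d 1 θ = 1 := by
  simp [sphereRestrict]

lemma continuous_regularized_rpow {d : ℕ} (ω : USphere d) (β : ℝ) {ε : ℝ} (hε : 0 < ε) :
    Continuous fun θ => (chordSq ω θ + ε) ^ β :=
  ((continuous_chordSq ω).add continuous_const).rpow_const fun θ =>
    Or.inl (add_pos_of_nonneg_of_pos (chordSq_nonneg ω θ) hε).ne'

lemma integrable_of_continuous {d : ℕ} {E : Type*} [NormedAddCommGroup E] {f : USphere d → E}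
    (hf : Continuous f) :
    Integrable f (surfMeasure d) :=
  hf.integrable_of_hasCompactSupport (HasCompactSupport.of_compactSpace _)

/-- The identity for `P = 1`, divided by `β + 1`, controls the exponent `β` by `β + 1` with
constants independent of `ε`. The coefficient on the left is positive exactly in the integrable
range. -/
lemma integral_regularized_rpow_le {d : ℕ} (hd : 2 ≤ d) (ω : USphere d) {β : ℝ}
    (hβ : β < 0) (hβ1 : β ≠ -1) {ε : ℝ} (hε : 0 < ε) :
    (β + ((d : ℝ) - 1) / 2) * ∫ θ, (chordSq ω θ + ε) ^ β ∂(surfMeasure d) ≤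
      ((d : ℝ) - 1) * ∫ θ, (chordSq ω θ + ε) ^ (β + 1) ∂(surfMeasure d) := by
  have hd' : (2 : ℝ) ≤ d := by exact_mod_cast hd
  have h := integral_regularized_eq_zero (isSolidHarmonic_one d) ω β hε
  simp only [sphereRestrict_one, mul_one, CharP.cast_eq_zero, zero_mul, add_zero] at h
  rw [integral_complex_ofReal, Complex.ofReal_eq_zero, integral_const_mul] at h
  have h := (mul_eq_zero.1 h).resolve_left fun h' => hβ1 (by linarith)
  rw [← integral_const_mul, ← integral_const_mul, ← sub_nonpos, ← integral_sub, ← h]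
  · have cv := continuous_chordSq ω
    have c1 := continuous_regularized_rpow ω (β - 1) hε
    have c2 := continuous_regularized_rpow ω β hε
    have c3 := continuous_regularized_rpow ω (β + 1) hε
    refine integral_mono (integrable_of_continuous (by fun_prop))
      (integrable_of_continuous (by fun_prop)) fun θ => ?_
    have hv := chordSq_nonneg ω θ
    set v := chordSq ω θ
    have hw : 0 < v + ε := by positivity
    have e1 : (v + ε) ^ β = (v + ε) * (v + ε) ^ (β - 1) := by
      rw [← Real.rpow_one_add' hw.le] <;> ring_nf; exact hβ.ne
    have e2 : (v + ε) ^ (β + 1) = (v + ε) * (v + ε) ^ β := by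
      rw [Real.rpow_add_one hw.ne', mul_comm]
    have p1 : 0 < (v + ε) ^ (β - 1) := Real.rpow_pos_of_pos hw _
    have p2 : 0 < (v + ε) ^ β := Real.rpow_pos_of_pos hw _
    -- Multiplication by `β < 0` reverses this, so the first term of the identity is at least `β (v
    -- + ε) ^ β`.
    have i1 : v * (1 - v) * (v + ε) ^ (β - 1) ≤ (v + ε) ^ β := by
      rw [e1]
      exact mul_le_mul_of_nonneg_right (by nlinarith) p1.le
    have i2 : (v + ε) * (v + ε) ^ β ≥ v * (v + ε) ^ β :=
      mul_le_mul_of_nonneg_right (by linarith) p2.le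
    have i3 := mul_le_mul_of_nonpos_left i1 hβ.le
    have i4 := mul_le_mul_of_nonneg_left i2 (by linarith : 0 ≤ (d : ℝ) - 1)
    simp only [e2]
    linarith
  · exact (integrable_of_continuous (continuous_regularized_rpow ω β hε)).const_mul _
  · exact (integrable_of_continuous (continuous_regularized_rpow ω (β + 1) hε)).const_mul _

/-- Raising the exponent by one, `n` times at most, reaches the bounded range `β ≥ 0`. Negative
integers are excluded because the chain would pass through `-1`, where the identity degenerates. -/
lemma exists_integral_regularized_rpow_le {d : ℕ} (hd : 2 ≤ d) (ω : USphere d) (n : ℕ) :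
    ∀ β : ℝ, -(((d : ℝ) - 1) / 2) < β → -(n : ℝ) ≤ β → (∀ m : ℕ, β ≠ -(m + 1 : ℝ)) →
      ∃ M, ∀ ε ∈ Set.Ioc (0 : ℝ) 1, ∫ θ, (chordSq ω θ + ε) ^ β ∂(surfMeasure d) ≤ M := by
  have hbase : ∀ β : ℝ, 0 ≤ β →
      ∃ M, ∀ ε ∈ Set.Ioc (0 : ℝ) 1, ∫ θ, (chordSq ω θ + ε) ^ β ∂(surfMeasure d) ≤ M := by
    intro β hβ
    refine ⟨∫ _θ, (2 : ℝ) ^ β ∂(surfMeasure d), fun ε hε => ?_⟩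
    refine integral_mono (integrable_of_continuous (continuous_regularized_rpow ω β hε.1))
      (integrable_const _) fun θ => ?_
    have := chordSq_nonneg ω θ
    have := chordSq_le_one ω θ
    exact Real.rpow_le_rpow (by linarith [hε.1]) (by linarith [hε.2]) hβ
  induction n with
  | zero => exact fun β _ h _ => hbase β (by simpa using h)
  | succ n ih =>
    intro β h1 h2 h3
    rcases le_or_gt 0 β with h0 | h0
    · exact hbase β h0
    obtain ⟨M, hM⟩ := ih (β + 1) (by linarith) (by push_cast at h2; linarith) (fun m hm => by
      apply h3 (m + 1); push_cast; linarith)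
    have hd' : (2 : ℝ) ≤ d := by exact_mod_cast hd
    refine ⟨((d : ℝ) - 1) * M / (β + ((d : ℝ) - 1) / 2), fun ε hε => ?_⟩
    rw [le_div_iff₀ (by linarith), mul_comm]
    refine (integral_regularized_rpow_le hd ω h0 (by simpa using h3 0) hε.1).trans ?_
    exact mul_le_mul_of_nonneg_left (hM ε hε) (by linarith)

/-- An atom at `ω` would contribute its mass times `ε ^ β` to a bounded integral. The exponent
`-1/4` is negative and admissible for every `d ≥ 2`. -/
lemma surfMeasure_singleton {d : ℕ} (hd : 2 ≤ d) (ω : USphere d) : surfMeasure d {ω} = 0 := by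
  have hd' : (2 : ℝ) ≤ d := by exact_mod_cast hd
  obtain ⟨M, hM⟩ := exists_integral_regularized_rpow_le hd ω 1 (-1 / 4) (by linarith) (by norm_num)
    (fun m hm => by have : (0 : ℝ) ≤ m := m.cast_nonneg; linarith)
  have hle : ∀ ε ∈ Set.Ioc (0 : ℝ) 1, (surfMeasure d).real {ω} ≤ M * ε ^ (1 / 4 : ℝ) := by
    intro ε hε
    have h1 : ∫ θ in {ω}, (chordSq ω θ + ε) ^ (-1 / 4 : ℝ) ∂(surfMeasure d) ≤ M :=
      (setIntegral_le_integral (integrable_of_continuous (continuous_regularized_rpow ω _ hε.1))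
        (Eventually.of_forall fun θ => Real.rpow_nonneg
          (add_nonneg (chordSq_nonneg ω θ) hε.1.le) _)).trans (hM ε hε)
    rw [integral_singleton, chordSq_eq_zero_iff.2 rfl, zero_add, smul_eq_mul] at h1
    have h2 : ε ^ (-1 / 4 : ℝ) * ε ^ (1 / 4 : ℝ) = 1 := by
      rw [← Real.rpow_add hε.1]; norm_num
    calc (surfMeasure d).real {ω}
        = (surfMeasure d).real {ω} * ε ^ (-1 / 4 : ℝ) * ε ^ (1 / 4 : ℝ) := by
          rw [mul_assoc, h2, mul_one]
      _ ≤ M * ε ^ (1 / 4 : ℝ) := mul_le_mul_of_nonneg_right h1 (Real.rpow_nonneg hε.1.le _)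
  have hlim : Tendsto (fun ε : ℝ => M * ε ^ (1 / 4 : ℝ)) (𝓝[>] 0) (𝓝 0) := by
    have : Continuous fun ε : ℝ => M * ε ^ (1 / 4 : ℝ) :=
      continuous_const.mul (Real.continuous_rpow_const (by norm_num))
    have h := (this.tendsto 0).mono_left (nhdsWithin_le_nhds (s := Set.Ioi (0 : ℝ)))
    rwa [Real.zero_rpow (by norm_num), mul_zero] at h
  have h0 := ge_of_tendsto hlim (Filter.mem_of_superset (Ioc_mem_nhdsGT one_pos) hle)
  exact (measureReal_eq_zero_iff).1 (le_antisymm h0 measureReal_nonneg)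

lemma ae_chordSq_pos {d : ℕ} (hd : 2 ≤ d) (ω : USphere d) :
    ∀ᵐ θ ∂(surfMeasure d), 0 < chordSq ω θ := by
  have h : ∀ᵐ θ ∂(surfMeasure d), θ ≠ ω := by
    rw [ae_iff]
    simpa using surfMeasure_singleton hd ω
  filter_upwards [h] with θ hθ
  exact (chordSq_nonneg ω θ).lt_of_ne' fun h => hθ (chordSq_eq_zero_iff.1 h)

lemma measurable_chordSq_rpow {d : ℕ} (ω : USphere d) (β : ℝ) :
    Measurable fun θ => chordSq ω θ ^ β :=
  (continuous_chordSq ω).measurable.pow_const β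

lemma tendsto_regularized_rpow {v : ℝ} (hv : 0 < v) (β : ℝ) :
    Tendsto (fun n : ℕ => (v + 1 / ((n : ℝ) + 1)) ^ β) atTop (𝓝 (v ^ β)) := by
  have h : Tendsto (fun n : ℕ => v + 1 / ((n : ℝ) + 1)) atTop (𝓝 v) := by
    simpa using (tendsto_one_div_add_atTop_nhds_zero_nat (𝕜 := ℝ)).const_add v
  exact h.rpow_const (Or.inl hv.ne')

lemma one_div_nat_add_one_mem (n : ℕ) : 1 / ((n : ℝ) + 1) ∈ Set.Ioc (0 : ℝ) 1 :=
  ⟨by positivity, by rw [div_le_one (by positivity)]; linarith [(n.cast_nonneg : (0 : ℝ) ≤ n)]⟩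

/-- Powers of the distance exceeding minus the dimension are integrable on the sphere. -/
lemma integrable_chordSq_rpow {d : ℕ} (hd : 2 ≤ d) (ω : USphere d) {β : ℝ}
    (hβ : -(((d : ℝ) - 1) / 2) < β) :
    Integrable (fun θ => chordSq ω θ ^ β) (surfMeasure d) := by
  have key : ∀ β : ℝ, -(((d : ℝ) - 1) / 2) < β → (∀ m : ℕ, β ≠ -(m + 1 : ℝ)) →
      Integrable (fun θ => chordSq ω θ ^ β) (surfMeasure d) := by
    intro β hβ hm
    obtain ⟨n, hn⟩ := exists_nat_ge (-β)
    obtain ⟨M, hM⟩ := exists_integral_regularized_rpow_le hd ω n β hβ (by linarith) hm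
    refine ⟨(measurable_chordSq_rpow ω β).aestronglyMeasurable, ?_⟩
    rw [hasFiniteIntegral_iff_ofReal (Eventually.of_forall fun θ =>
      Real.rpow_nonneg (chordSq_nonneg ω θ) _)]
    -- Fatou's lemma along `ε = 1/(n+1)`, with the uniform bound `M`.
    have h1 : ∫⁻ θ, ENNReal.ofReal (chordSq ω θ ^ β) ∂(surfMeasure d) =
        ∫⁻ θ, liminf (fun n : ℕ => ENNReal.ofReal ((chordSq ω θ + 1 / ((n : ℝ) + 1)) ^ β)) atTop
          ∂(surfMeasure d) := by
      refine lintegral_congr_ae ?_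
      filter_upwards [ae_chordSq_pos hd ω] with θ hθ
      exact (ENNReal.tendsto_ofReal (tendsto_regularized_rpow hθ β)).liminf_eq.symm
    rw [h1]
    refine lt_of_le_of_lt (b := ENNReal.ofReal M) ?_ ENNReal.ofReal_lt_top
    refine (lintegral_liminf_le fun n => (continuous_regularized_rpow ω β
      (one_div_nat_add_one_mem n).1).measurable.ennreal_ofReal).trans ?_
    refine (liminf_le_liminf (Eventually.of_forall fun n => ?_)).trans (liminf_const _).le
    rw [← ofReal_integral_eq_lintegral_ofReal
      (integrable_of_continuous (continuous_regularized_rpow ω β (one_div_nat_add_one_mem n).1))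
      (Eventually.of_forall fun θ => Real.rpow_nonneg
        (add_nonneg (chordSq_nonneg ω θ) (one_div_nat_add_one_mem n).1.le) _)]
    exact ENNReal.ofReal_le_ofReal (hM _ (one_div_nat_add_one_mem n))
  by_cases hm : ∀ m : ℕ, β ≠ -(m + 1 : ℝ)
  · exact key β hβ hm
  · push Not at hm
    obtain ⟨m, hm⟩ := hm
    -- At a negative integer, compare with a slightly smaller admissible exponent in `(β - 1, β)`:
    -- since `v ≤ 1`, its power dominates.
    obtain ⟨β', h1, h2⟩ := exists_between (max_lt hβ (sub_one_lt β))
    rw [max_lt_iff] at h1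
    refine (key β' h1.1 fun m' hm' => ?_).mono'
      (measurable_chordSq_rpow ω β).aestronglyMeasurable ?_
    · have a1 : m < m' := by
        have : (m : ℝ) < m' := by linarith
        exact_mod_cast this
      have a2 : m' < m + 1 := by
        have : (m' : ℝ) < m + 1 := by linarith
        exact_mod_cast this
      omega
    · filter_upwards [ae_chordSq_pos hd ω] with θ hθ
      rw [Real.norm_of_nonneg (Real.rpow_nonneg hθ.le _)]
      exact Real.rpow_le_rpow_of_exponent_ge hθ (chordSq_le_one ω θ) h2.le

/-! ### The recursion for the moments -/

/-- The integral of a polynomial against a power of the squared distance to `ω`. -/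
def chordMoment {d : ℕ} (P : MvPolynomial (Fin d) ℂ) (ω : USphere d) (β : ℝ) : ℂ :=
  ∫ θ, ((chordSq ω θ ^ β : ℝ) : ℂ) * sphereRestrict d P θ ∂(surfMeasure d)

lemma exists_norm_sphereRestrict_le {d : ℕ} (P : MvPolynomial (Fin d) ℂ) :
    ∃ M, 0 ≤ M ∧ ∀ θ, ‖sphereRestrict d P θ‖ ≤ M :=
  ⟨‖sphereRestrict d P‖, norm_nonneg _, fun θ => (sphereRestrict d P).norm_coe_le_norm θ⟩

lemma integrable_chordSq_rpow_mul {d : ℕ} (hd : 2 ≤ d) (P : MvPolynomial (Fin d) ℂ)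
    (ω : USphere d) {β : ℝ} (hβ : -(((d : ℝ) - 1) / 2) < β) :
    Integrable (fun θ => ((chordSq ω θ ^ β : ℝ) : ℂ) * sphereRestrict d P θ) (surfMeasure d) := by
  obtain ⟨M, -, hM⟩ := exists_norm_sphereRestrict_le P
  exact (integrable_chordSq_rpow hd ω hβ).ofReal.mul_bdd
    (sphereRestrict d P).continuous.aestronglyMeasurable (Eventually.of_forall hM)

lemma chordMoment_recursion {d k : ℕ} (hd : 2 ≤ d) {P : MvPolynomial (Fin d) ℂ}
    (hP : IsSolidHarmonic d k P) (ω : USphere d) {β : ℝ} (hβ : -(((d : ℝ) - 1) / 2) < β) :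
    (((β + 1) * (β + ((d : ℝ) - 1) / 2) : ℝ) : ℂ) * chordMoment P ω β =
      (((β + 1 - k) * (β + k + d - 1) : ℝ) : ℂ) * chordMoment P ω (β + 1) := by
  have hd' : (2 : ℝ) ≤ d := by exact_mod_cast hd
  obtain ⟨M, hM0, hM⟩ := exists_norm_sphereRestrict_le P
  set c : ℝ := ((d : ℝ) - 1) / 2 with hc
  have hc0 : 0 ≤ c := by simp only [hc]; linarith
  set κ : ℝ := (k : ℝ) * (k + d - 2) with hκ
  have hi0 := integrable_chordSq_rpow_mul hd P ω hβ
  have hi1 := integrable_chordSq_rpow_mul hd P ω (by linarith : -(((d : ℝ) - 1) / 2) < β + 1)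
  let Φ (ε : ℝ) (v : ℝ) : ℝ := (β + 1) * (β * (v * (1 - v)) * (v + ε) ^ (β - 1)
        + c * (1 - 2 * v) * (v + ε) ^ β) + κ * (v + ε) ^ (β + 1)
  have hreg (n : ℕ) : ∫ θ, (Φ (1 / ((n : ℝ) + 1)) (chordSq ω θ) : ℂ) * sphereRestrict d P θ
      ∂(surfMeasure d) = 0 :=
    integral_regularized_eq_zero hP ω β (one_div_nat_add_one_mem n).1
  have hlim : Tendsto (fun n : ℕ => ∫ θ, (Φ (1 / ((n : ℝ) + 1)) (chordSq ω θ) : ℂ) *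
      sphereRestrict d P θ ∂(surfMeasure d)) atTop
      (𝓝 (∫ θ, (((β + 1) * (β + c) * chordSq ω θ ^ β -
        (β + 1 - k) * (β + k + d - 1) * chordSq ω θ ^ (β + 1) : ℝ) : ℂ) *
          sphereRestrict d P θ ∂(surfMeasure d))) := by
    -- Each term of `Φ` is at most a constant times `(v + ε) ^ β`, and this is at most `v ^ β` for
    -- `β < 0` and at most `2 ^ β` for `β ≥ 0`.
    refine tendsto_integral_of_dominated_convergence
      (fun θ => (|β + 1| * (|β| + c) + 2 * |κ|) * (chordSq ω θ ^ β + 2 ^ |β|) * M) (fun n => ?_)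
      ?_ (fun n => ?_) ?_
    · have cv := continuous_chordSq ω
      have c1 := continuous_regularized_rpow ω (β - 1) (one_div_nat_add_one_mem n).1
      have c2 := continuous_regularized_rpow ω β (one_div_nat_add_one_mem n).1
      have c3 := continuous_regularized_rpow ω (β + 1) (one_div_nat_add_one_mem n).1
      have : Continuous fun θ => Φ (1 / ((n : ℝ) + 1)) (chordSq ω θ) := by
        simp only [Φ]; fun_prop
      exact ((Complex.continuous_ofReal.comp this).mul
        (sphereRestrict d P).continuous).aestronglyMeasurable
    · exact (((integrable_chordSq_rpow hd ω hβ).add (integrable_const _)).const_mul _).mul_const _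
    · filter_upwards [ae_chordSq_pos hd ω] with θ hv
      rw [norm_mul, Complex.norm_real, Real.norm_eq_abs]
      refine mul_le_mul ?_ (hM θ) (norm_nonneg _) (by positivity)
      have hv1 := chordSq_le_one ω θ
      obtain ⟨hε, hε1⟩ := one_div_nat_add_one_mem n
      set v := chordSq ω θ
      set ε := 1 / ((n : ℝ) + 1)
      have hw : 0 < v + ε := by positivity
      have e1 : (v + ε) ^ β = (v + ε) * (v + ε) ^ (β - 1) := by
        conv_lhs => rw [show β = β - 1 + 1 by ring, Real.rpow_add_one hw.ne', mul_comm]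
      have e2 : (v + ε) ^ (β + 1) = (v + ε) * (v + ε) ^ β := by
        rw [Real.rpow_add_one hw.ne', mul_comm]
      have p1 : 0 < (v + ε) ^ (β - 1) := Real.rpow_pos_of_pos hw _
      have p2 : 0 < (v + ε) ^ β := Real.rpow_pos_of_pos hw _
      have hb : (v + ε) ^ β ≤ v ^ β + 2 ^ |β| := by
        rcases le_or_gt 0 β with h0 | h0
        · rw [abs_of_nonneg h0]
          have := Real.rpow_le_rpow hw.le (by linarith : v + ε ≤ 2) h0
          have := Real.rpow_nonneg hv.le β
          linarith
        · have := Real.rpow_le_rpow_of_nonpos hv (by linarith : v ≤ v + ε) h0.le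
          have : (0 : ℝ) < 2 ^ |β| := by positivity
          linarith
      have b1 : |v * (1 - v) * (v + ε) ^ (β - 1)| ≤ (v + ε) ^ β := by
        rw [abs_of_nonneg (by have : 0 ≤ 1 - v := by linarith
                              positivity), e1]
        exact mul_le_mul_of_nonneg_right (by nlinarith) p1.le
      have b2 : |(1 - 2 * v) * (v + ε) ^ β| ≤ (v + ε) ^ β := by
        rw [abs_mul, abs_of_pos p2]
        exact mul_le_of_le_one_left p2.le (abs_le.2 ⟨by linarith, by linarith⟩)
      have b3 : |(v + ε) ^ (β + 1)| ≤ 2 * (v + ε) ^ β := by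
        rw [e2, abs_of_pos (by positivity)]
        exact mul_le_mul_of_nonneg_right (by linarith) p2.le
      calc |Φ ε v| = |(β + 1) * (β * (v * (1 - v) * (v + ε) ^ (β - 1))
            + c * ((1 - 2 * v) * (v + ε) ^ β)) + κ * (v + ε) ^ (β + 1)| := by
            simp only [Φ]; ring_nf
        _ ≤ |β + 1| * (|β| * |v * (1 - v) * (v + ε) ^ (β - 1)|
            + c * |(1 - 2 * v) * (v + ε) ^ β|) + |κ| * |(v + ε) ^ (β + 1)| := by
            refine (abs_add_le _ _).trans ?_
            rw [abs_mul, abs_mul κ]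
            gcongr
            refine (abs_add_le _ _).trans ?_
            rw [abs_mul, abs_mul c, abs_of_nonneg hc0]
        _ ≤ |β + 1| * (|β| * (v + ε) ^ β + c * (v + ε) ^ β) + |κ| * (2 * (v + ε) ^ β) := by
            gcongr
        _ = (|β + 1| * (|β| + c) + 2 * |κ|) * (v + ε) ^ β := by ring
        _ ≤ _ := by gcongr
    · filter_upwards [ae_chordSq_pos hd ω] with θ hv
      refine Tendsto.mul_const _ ((Complex.continuous_ofReal.tendsto _).comp ?_)
      set v := chordSq ω θ
      have e1 : v ^ β = v * v ^ (β - 1) := by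
        conv_lhs => rw [show β = β - 1 + 1 by ring, Real.rpow_add_one hv.ne', mul_comm]
      have e2 : v ^ (β + 1) = v * v ^ β := by
        rw [Real.rpow_add_one hv.ne', mul_comm]
      -- The coefficient of `v ^ (β + 1)` factors because `(β+1)(β+d-1) - k(k+d-2) =
      -- (β+1-k)(β+k+d-1)`.
      have : (β + 1) * (β + c) * v ^ β - (β + 1 - k) * (β + k + d - 1) * v ^ (β + 1) =
          (β + 1) * (β * (v * (1 - v)) * v ^ (β - 1) + c * (1 - 2 * v) * v ^ β)
            + κ * v ^ (β + 1) := by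
        rw [e2, e1]; simp only [hκ, hc]; ring
      rw [this]
      exact ((((tendsto_regularized_rpow hv (β - 1)).const_mul _).add
        ((tendsto_regularized_rpow hv β).const_mul _)).const_mul _).add
        ((tendsto_regularized_rpow hv (β + 1)).const_mul _)
  simp only [hreg] at hlim
  have h0 := tendsto_nhds_unique hlim tendsto_const_nhds
  rw [← sub_eq_zero, ← h0, chordMoment, chordMoment, ← integral_const_mul, ← integral_const_mul,
    ← integral_sub (hi0.const_mul _) (hi1.const_mul _)]
  refine integral_congr_ae (Eventually.of_forall fun θ => ?_)
  simp only
  push_cast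
  ring

/-! ### Gamma quotients and the moments of the constant function -/

/-- Log-convexity: `y` and `x + δ` are convex combinations of `x` and `y + δ` with the two weights
interchanged. It makes `x ↦ Γ(x) / Γ(x + δ)` antitone. -/
lemma Gamma_mul_Gamma_add_le {x y δ : ℝ} (hx : 0 < x) (hxy : x ≤ y) (hδ : 0 ≤ δ) :
    Real.Gamma y * Real.Gamma (x + δ) ≤ Real.Gamma x * Real.Gamma (y + δ) := by
  rcases hxy.eq_or_lt with rfl | hxy
  · exact le_rfl
  rcases hδ.eq_or_lt with rfl | hδ
  · simp [mul_comm]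
  have hD : 0 < y + δ - x := by linarith
  have hG1 := Real.Gamma_pos_of_pos hx
  have hG2 := Real.Gamma_pos_of_pos (by linarith : 0 < y + δ)
  have ha : 0 < δ / (y + δ - x) := by positivity
  have hb : 0 < (y - x) / (y + δ - x) := div_pos (by linarith) hD
  have hab : δ / (y + δ - x) + (y - x) / (y + δ - x) = 1 := by field_simp; ring
  have h1 := Real.Gamma_mul_add_mul_le_rpow_Gamma_mul_rpow_Gamma hx
    (by linarith : 0 < y + δ) ha hb hab
  have h2 := Real.Gamma_mul_add_mul_le_rpow_Gamma_mul_rpow_Gamma hx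
    (by linarith : 0 < y + δ) hb ha (by rw [add_comm]; exact hab)
  have e1 : δ / (y + δ - x) * x + (y - x) / (y + δ - x) * (y + δ) = y := by field_simp; ring
  have e2 : (y - x) / (y + δ - x) * x + δ / (y + δ - x) * (y + δ) = x + δ := by field_simp; ring
  rw [e1] at h1
  rw [e2] at h2
  refine (mul_le_mul h1 h2 (Real.Gamma_pos_of_pos (by linarith)).le (by positivity)).trans_eq ?_
  set p := δ / (y + δ - x)
  set q := (y - x) / (y + δ - x)
  calc Real.Gamma x ^ p * Real.Gamma (y + δ) ^ q * (Real.Gamma x ^ q * Real.Gamma (y + δ) ^ p)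
      = (Real.Gamma x ^ p * Real.Gamma x ^ q) *
          (Real.Gamma (y + δ) ^ p * Real.Gamma (y + δ) ^ q) := by
        ring
    _ = _ := by rw [← Real.rpow_add hG1, ← Real.rpow_add hG2, hab, Real.rpow_one, Real.rpow_one]

lemma Gamma_add_natCast {x : ℝ} (hx : 0 < x) (k : ℕ) :
    Real.Gamma (x + k) = (∏ j ∈ Finset.range k, (x + j)) * Real.Gamma x := by
  induction k with
  | zero => simp
  | succ k ih =>
    rw [Finset.prod_range_succ, Nat.cast_succ, ← add_assoc, Real.Gamma_add_one (by positivity), ih]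
    ring

lemma tendsto_add_div_add_natCast (a b : ℝ) :
    Tendsto (fun n : ℕ => ((n : ℝ) + a) / (n + b)) atTop (𝓝 1) := by
  have h1 : Tendsto (fun n : ℕ => 1 + (a - b) / ((n : ℝ) + b)) atTop (𝓝 (1 + 0)) :=
    (tendsto_const_nhds.div_atTop
      (tendsto_natCast_atTop_atTop.atTop_add tendsto_const_nhds)).const_add 1
  rw [add_zero] at h1
  refine h1.congr' ?_
  filter_upwards [(tendsto_natCast_atTop_atTop (R := ℝ)).eventually_gt_atTop (-b)] with n hn
  have : (n : ℝ) + b ≠ 0 := by linarith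
  field_simp
  ring

/-- A uniqueness theorem in the style of Bohr and Mollerup. -/
lemma eq_of_antitone_of_recursion {f q r : ℝ → ℝ}
    (hf : ∀ x y, 0 ≤ x → x ≤ y → f y ≤ f x) (hq : ∀ x y, 0 ≤ x → x ≤ y → q y ≤ q x)
    (hqpos : ∀ x, 0 ≤ x → 0 < q x) (hr : ∀ x, 0 ≤ x → 0 < r x)
    (hfr : ∀ x, 0 ≤ x → f (x + 1) = r x * f x) (hqr : ∀ x, 0 ≤ x → q (x + 1) = r x * q x)
    (hlim : Tendsto (fun n : ℕ => r n) atTop (𝓝 1)) (h0 : f 0 = q 0) {x : ℝ} (hx : 0 ≤ x) :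
    f x = q x := by
  -- The quotient `f / q` is 1-periodic and equals `1` at the integers. On `[0, 1]`, moving by `n`
  -- and using monotonicity of both functions traps it between `r n` and `1 / r n`.
  have hper : ∀ (n : ℕ) (x : ℝ), 0 ≤ x → f (x + n) / q (x + n) = f x / q x := by
    intro n
    induction n with
    | zero => simp
    | succ n ih =>
      intro x hx
      have hxn : 0 ≤ x + n := by positivity
      rw [Nat.cast_succ, ← add_assoc, hfr _ hxn, hqr _ hxn,
        mul_div_mul_left _ _ (hr _ hxn).ne', ih x hx]
  have hnat (n : ℕ) : f n = q n := by
    have h := hper n 0 le_rfl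
    rw [zero_add, h0, div_self (hqpos 0 le_rfl).ne',
      div_eq_one_iff_eq (hqpos n n.cast_nonneg).ne'] at h
    exact h
  have hunit : ∀ x, 0 ≤ x → x ≤ 1 → f x / q x = 1 := by
    intro x hx hx1
    have up (n : ℕ) : f x / q x ≤ (r n)⁻¹ := by
      have hn : (0 : ℝ) ≤ n := n.cast_nonneg
      rw [← hper n x hx]
      have h1 := hf n (x + n) hn (by linarith)
      have h2 := hq (x + n) (n + 1) (by linarith) (by linarith)
      rw [hnat n] at h1
      rw [hqr n hn] at h2
      have := hqpos n hn
      have := hr n hn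
      calc f (x + n) / q (x + n) ≤ q n / q (x + n) := by
            gcongr; exact (hqpos _ (by positivity)).le
        _ ≤ q n / (r n * q n) := by gcongr
        _ = (r n)⁻¹ := by field_simp
    have lo (n : ℕ) : r n ≤ f x / q x := by
      have hn : (0 : ℝ) ≤ n := n.cast_nonneg
      rw [← hper n x hx]
      have h1 := hf (x + n) (n + 1) (by linarith) (by linarith)
      have h2 := hq n (x + n) hn (by linarith)
      rw [hfr n hn, hnat n] at h1
      have h3 := hqpos n hn
      have h4 := hr n hn
      rw [le_div_iff₀ (hqpos _ (by positivity))]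
      exact (mul_le_mul_of_nonneg_left h2 h4.le).trans h1
    refine le_antisymm ?_ (le_of_tendsto' hlim lo)
    have := hlim.inv₀ one_ne_zero
    rw [inv_one] at this
    exact ge_of_tendsto' this up
  have h := hper ⌊x⌋₊ (x - ⌊x⌋₊) (sub_nonneg.2 (Nat.floor_le hx))
  rw [sub_add_cancel, hunit _ (sub_nonneg.2 (Nat.floor_le hx))
    (by linarith [Nat.lt_floor_add_one x])] at h
  exact (div_eq_one_iff_eq (hqpos x hx).ne').1 h

/-- The normalising constant of the moments of the squared distance on the sphere. -/
def chordConst (d : ℕ) : ℝ := Real.pi ^ (((d : ℝ) - 1) / 2) * 2 ^ ((d : ℝ) - 1)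

lemma chordConst_pos (d : ℕ) : 0 < chordConst d := by
  unfold chordConst; positivity

/-- The volume of the unit ball, rewritten by Legendre's duplication formula into the shape of the
moment formula at `β = 0`. -/
lemma surfMeasure_real_univ {d : ℕ} (hd : 2 ≤ d) :
    (surfMeasure d).real Set.univ =
      chordConst d * Real.Gamma (((d : ℝ) - 1) / 2) / Real.Gamma ((d : ℝ) - 1) := by
  have hd' : (2 : ℝ) ≤ d := by exact_mod_cast hd
  have : Nonempty (Fin d) := ⟨⟨0, by omega⟩⟩
  have hG : 0 < Real.Gamma ((d : ℝ) / 2 + 1) := Real.Gamma_pos_of_pos (by positivity)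
  have h1 : (surfMeasure d).real Set.univ = d * (√Real.pi ^ d / Real.Gamma ((d : ℝ) / 2 + 1)) := by
    rw [surfMeasure, Measure.toSphere_real_apply_univ, measureReal_def, EuclideanSpace.volume_ball]
    simp only [finrank_euclideanSpace, Fintype.card_fin, ENNReal.ofReal_one, one_pow, one_mul]
    rw [ENNReal.toReal_ofReal (by positivity)]
  have hdup := Real.Gamma_mul_Gamma_add_half (((d : ℝ) - 1) / 2)
  rw [show ((d : ℝ) - 1) / 2 + 1 / 2 = d / 2 by ring, show 2 * (((d : ℝ) - 1) / 2) = d - 1 by ring,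
    show 1 - ((d : ℝ) - 1) = -((d : ℝ) - 1) + 1 by ring, Real.rpow_add_one two_ne_zero,
    Real.rpow_neg zero_le_two] at hdup
  have p1 := Real.Gamma_pos_of_pos (by linarith : 0 < ((d : ℝ) - 1) / 2)
  have p2 := Real.Gamma_pos_of_pos (by linarith : 0 < (d : ℝ) / 2)
  have p3 := Real.Gamma_pos_of_pos (by linarith : 0 < (d : ℝ) - 1)
  have p4 : (0 : ℝ) < 2 ^ ((d : ℝ) - 1) := by positivity
  have hpi : √Real.pi ^ d = Real.pi ^ (((d : ℝ) - 1) / 2) * √Real.pi := by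
    rw [Real.sqrt_eq_rpow, ← Real.rpow_natCast, ← Real.rpow_mul Real.pi_pos.le,
      ← Real.rpow_add Real.pi_pos]
    congr 1; ring
  rw [h1, Real.Gamma_add_one (by positivity), hpi, chordConst]
  field_simp at hdup ⊢
  linear_combination -hdup

instance surfMeasure_isOpenPosMeasure (d : ℕ) : (surfMeasure d).IsOpenPosMeasure := by
  unfold surfMeasure; infer_instance

lemma chordMoment_one {d : ℕ} (ω : USphere d) (β : ℝ) :
    chordMoment 1 ω β = ((∫ θ, chordSq ω θ ^ β ∂(surfMeasure d) : ℝ) : ℂ) := by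
  simp [chordMoment, sphereRestrict_one, ← integral_complex_ofReal]

lemma integral_chordSq_rpow_of_nonneg {d : ℕ} (hd : 2 ≤ d) (ω : USphere d) {β : ℝ} (hβ : 0 ≤ β) :
    ∫ θ, chordSq ω θ ^ β ∂(surfMeasure d) =
      chordConst d * Real.Gamma (β + ((d : ℝ) - 1) / 2) / Real.Gamma (β + ((d : ℝ) - 1)) := by
  have hd' : (2 : ℝ) ≤ d := by exact_mod_cast hd
  set c : ℝ := ((d : ℝ) - 1) / 2 with hc
  have hc0 : 0 < c := by simp only [hc]; linarith
  have hdc : (d : ℝ) - 1 = 2 * c := by simp only [hc]; ring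
  have hC := chordConst_pos d
  have hint (x : ℝ) (hx : 0 ≤ x) : Integrable (fun θ => chordSq ω θ ^ x) (surfMeasure d) :=
    integrable_chordSq_rpow hd ω (by linarith)
  refine eq_of_antitone_of_recursion (r := fun x => (x + c) / (x + 2 * c))
    (f := fun x => ∫ θ, chordSq ω θ ^ x ∂(surfMeasure d))
    (q := fun x => chordConst d * Real.Gamma (x + c) / Real.Gamma (x + ((d : ℝ) - 1)))
    ?_ ?_ ?_ ?_ ?_ ?_ ?_ ?_ hβ
  · intro x y hx hxy
    refine integral_mono_ae (hint y (hx.trans hxy)) (hint x hx) ?_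
    filter_upwards [ae_chordSq_pos hd ω] with θ hθ
    exact Real.rpow_le_rpow_of_exponent_ge hθ (chordSq_le_one ω θ) hxy
  · intro x y hx hxy
    have p1 := Real.Gamma_pos_of_pos (by linarith : 0 < x + ((d : ℝ) - 1))
    have p2 := Real.Gamma_pos_of_pos (by linarith : 0 < y + ((d : ℝ) - 1))
    rw [div_le_div_iff₀ p2 p1, mul_assoc, mul_assoc]
    refine mul_le_mul_of_nonneg_left ?_ hC.le
    have := Gamma_mul_Gamma_add_le (by linarith : 0 < x + c) (by linarith : x + c ≤ y + c) hc0.le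
    rwa [add_assoc, add_assoc, ← two_mul, ← hdc] at this
  · intro x hx
    have p1 := Real.Gamma_pos_of_pos (by linarith : 0 < x + ((d : ℝ) - 1))
    have p2 := Real.Gamma_pos_of_pos (by linarith : 0 < x + c)
    positivity
  · intro x hx
    positivity
  · intro x hx
    have h := chordMoment_recursion hd (isSolidHarmonic_one d) ω (by linarith : -c < x)
    rw [chordMoment_one, chordMoment_one, ← Complex.ofReal_mul, ← Complex.ofReal_mul,
      Complex.ofReal_inj] at h
    simp only [CharP.cast_eq_zero, sub_zero, add_zero] at h
    rw [add_sub_assoc, ← hc, hdc, mul_assoc, mul_assoc] at h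
    have h := mul_left_cancel₀ (by linarith : x + 1 ≠ 0) h
    have : x + 2 * c ≠ 0 := by positivity
    field_simp
    linarith
  · intro x hx
    have p1 := Real.Gamma_pos_of_pos (by linarith : 0 < x + 2 * c)
    rw [add_right_comm, Real.Gamma_add_one (by positivity), hdc, add_right_comm x 1,
      Real.Gamma_add_one (by positivity)]
    have : x + 2 * c ≠ 0 := by positivity
    field_simp
  · exact tendsto_add_div_add_natCast _ _
  · simpa [hc] using surfMeasure_real_univ hd

/-! ### The Funk-Hecke formula -/

lemma sphereRestrict_neg {d k : ℕ} {P : MvPolynomial (Fin d) ℂ} (hP : P.IsHomogeneous k)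
    (ω : USphere d) : sphereRestrict d P (-ω) = (-1) ^ k * sphereRestrict d P ω := by
  simp only [sphereRestrict, ContinuousMap.coe_mk, MvPolynomial.eval_eq', Finset.mul_sum]
  refine Finset.sum_congr rfl fun m hm => ?_
  have hdeg : ∑ i, m i = k := by
    have := hP (MvPolynomial.mem_support_iff.1 hm)
    rw [Finsupp.weight_apply, Finsupp.sum_fintype _ _ (by simp)] at this
    simpa using this
  rw [← hdeg, ← Finset.prod_pow_eq_pow_sum, mul_left_comm, ← Finset.prod_mul_distrib]
  congr 1
  refine Finset.prod_congr rfl fun i _ => ?_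
  rw [← mul_pow]
  simp

/-- The value of `chordMoment` relative to the value of the polynomial at `-ω`. -/
def chordMomentCoeff (d k : ℕ) (β : ℝ) : ℝ :=
  chordConst d * (∏ j ∈ Finset.range k, (β - j)) * Real.Gamma (β + ((d : ℝ) - 1) / 2) /
    Real.Gamma (β + ((d : ℝ) - 1) + k)

/-- Both sides are the product of `β + 1 - j` over `0 ≤ j ≤ k`. -/
lemma prod_range_shift (β : ℝ) (k : ℕ) :
    (β + 1 - k) * ∏ j ∈ Finset.range k, (β + 1 - j) =
      (β + 1) * ∏ j ∈ Finset.range k, (β - j) := by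
  rw [mul_comm, ← Finset.prod_range_succ (fun j : ℕ => β + 1 - j), Finset.prod_range_succ']
  simp only [Nat.cast_add, Nat.cast_one, CharP.cast_eq_zero, sub_zero, add_sub_add_right_eq_sub]
  ring

lemma chordMomentCoeff_recursion {d : ℕ} (hd : 2 ≤ d) (k : ℕ) {β : ℝ}
    (hβ : -(((d : ℝ) - 1) / 2) < β) :
    (β + 1) * (β + ((d : ℝ) - 1) / 2) * chordMomentCoeff d k β =
      (β + 1 - k) * (β + k + d - 1) * chordMomentCoeff d k (β + 1) := by
  have hd' : (2 : ℝ) ≤ d := by exact_mod_cast hd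
  have hk : (0 : ℝ) ≤ k := k.cast_nonneg
  have h2 : 0 < β + ((d : ℝ) - 1) + k := by linarith
  have p2 := Real.Gamma_pos_of_pos h2
  unfold chordMomentCoeff
  rw [add_right_comm β 1, Real.Gamma_add_one (by linarith : β + ((d : ℝ) - 1) / 2 ≠ 0),
    add_right_comm β 1, add_right_comm _ 1 (k : ℝ), Real.Gamma_add_one h2.ne']
  have h := prod_range_shift β k
  have e : β + k + d - 1 = β + ((d : ℝ) - 1) + k := by ring
  rw [e]
  field_simp
  linear_combination -(chordConst d * (2 * β + (d - 1)) * Real.Gamma ((β * 2 + (d - 1)) / 2)) * h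

/-- On the sphere `v` attains its maximum `1` only at `-ω`, so the normalised weights `v ^ n` form
an approximate identity there. -/
lemma tendsto_chordMoment_div {d : ℕ} (P : MvPolynomial (Fin d) ℂ)
    (ω : USphere d) {β : ℝ} (hβ : 0 ≤ β) :
    Tendsto (fun n : ℕ => (∫ θ, chordSq ω θ ^ n ∂(surfMeasure d))⁻¹ • chordMoment P ω (β + n)) atTop
      (𝓝 (sphereRestrict d P (-ω))) := by
  have h1 : chordSq ω (-ω) = 1 := by
    have := chordSq_neg (-ω) (-ω)
    rw [neg_neg, chordSq_eq_zero_iff.2 rfl] at this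
    rw [this, sub_zero]
  have h := tendsto_setIntegral_pow_smul_of_unique_maximum_of_isCompact_of_continuousOn
    (μ := surfMeasure d) (s := Set.univ) (c := chordSq ω) (x₀ := -ω)
    (g := fun θ => ((chordSq ω θ ^ β : ℝ) : ℂ) * sphereRestrict d P θ) isCompact_univ
    (continuous_chordSq ω).continuousOn ?_ (fun θ _ => chordSq_nonneg ω θ)
    (by rw [h1]; exact one_pos)
    (by simp) ?_
  · simp only [h1, Real.one_rpow, Complex.ofReal_one, one_mul, Measure.restrict_univ] at h
    refine h.congr fun n => ?_
    rw [chordMoment]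
    congr 1
    refine integral_congr_ae (Eventually.of_forall fun θ => ?_)
    simp only [Complex.real_smul]
    rw [add_comm, Real.rpow_add_of_nonneg (chordSq_nonneg ω θ) n.cast_nonneg hβ, Real.rpow_natCast]
    push_cast
    ring
  · intro θ _ hθ
    rw [h1]
    refine (chordSq_le_one ω θ).lt_of_ne fun h' => hθ (chordSq_eq_zero_iff.1 ?_)
    rw [chordSq_neg, h', sub_self]
  · exact ((Complex.continuous_ofReal.comp ((continuous_chordSq ω).rpow_const
      fun _ => Or.inr hβ)).mul (sphereRestrict d P).continuous).continuousOn

lemma chordMomentCoeff_pos {d : ℕ} (hd : 2 ≤ d) (k : ℕ) {β : ℝ} (hβ : (k : ℝ) ≤ β) :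
    0 < chordMomentCoeff d k β := by
  have hd' : (2 : ℝ) ≤ d := by exact_mod_cast hd
  have hk : (0 : ℝ) ≤ k := k.cast_nonneg
  have p0 := chordConst_pos d
  have p1 := Real.Gamma_pos_of_pos (by linarith : 0 < β + ((d : ℝ) - 1) / 2)
  have p2 := Real.Gamma_pos_of_pos (by linarith : 0 < β + ((d : ℝ) - 1) + k)
  have p3 : 0 < ∏ j ∈ Finset.range k, (β - j) := Finset.prod_pos fun j hj => by
    have : (j : ℝ) < k := by exact_mod_cast Finset.mem_range.1 hj
    linarith
  unfold chordMomentCoeff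
  positivity

lemma tendsto_chordMomentCoeff_div {d : ℕ} (hd : 2 ≤ d) (k : ℕ) {β : ℝ} (hβ : (k : ℝ) ≤ β) :
    Tendsto (fun n : ℕ => chordMomentCoeff d 0 (β + n) / chordMomentCoeff d k (β + n)) atTop
      (𝓝 1) := by
  have hd' : (2 : ℝ) ≤ d := by exact_mod_cast hd
  have hk : (0 : ℝ) ≤ k := k.cast_nonneg
  have h : Tendsto (fun n : ℕ => ∏ j ∈ Finset.range k,
      (((n : ℝ) + (β + ((d : ℝ) - 1) + j)) / (n + (β - j)))) atTop (𝓝 1) := by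
    have := tendsto_finsetProd (Finset.range k) fun j _ =>
      tendsto_add_div_add_natCast (β + ((d : ℝ) - 1) + j) (β - j)
    simpa using this
  refine h.congr fun n => ?_
  have hn : (0 : ℝ) ≤ n := n.cast_nonneg
  have h1 : 0 < β + n + ((d : ℝ) - 1) := by linarith
  have p0 := chordConst_pos d
  have p1 := Real.Gamma_pos_of_pos (by linarith : 0 < β + n + ((d : ℝ) - 1) / 2)
  have p2 := Real.Gamma_pos_of_pos h1
  have p3 : 0 < ∏ j ∈ Finset.range k, (β + n - j) := Finset.prod_pos fun j hj => by
    have : (j : ℝ) < k := by exact_mod_cast Finset.mem_range.1 hj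
    linarith
  have p4 : 0 < ∏ j ∈ Finset.range k, (β + n + ((d : ℝ) - 1) + j) := Finset.prod_pos fun j _ => by
    positivity
  have e1 : ∏ j ∈ Finset.range k, ((n : ℝ) + (β + ((d : ℝ) - 1) + j)) =
      ∏ j ∈ Finset.range k, (β + n + ((d : ℝ) - 1) + j) :=
    Finset.prod_congr rfl fun j _ => by ring
  have e2 : ∏ j ∈ Finset.range k, ((n : ℝ) + (β - j)) = ∏ j ∈ Finset.range k, (β + n - j) :=
    Finset.prod_congr rfl fun j _ => by ring
  rw [Finset.prod_div_distrib, e1, e2, chordMomentCoeff, chordMomentCoeff, Gamma_add_natCast h1 k]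
  simp only [Finset.range_zero, Finset.prod_empty, mul_one, CharP.cast_eq_zero, add_zero]
  generalize Real.Gamma (β + n + ((d : ℝ) - 1) / 2) = G at p1 ⊢
  field_simp

lemma chordMoment_one_of_nonneg {d : ℕ} (hd : 2 ≤ d) (ω : USphere d) {β : ℝ} (hβ : 0 ≤ β) :
    chordMoment 1 ω β = (chordMomentCoeff d 0 β : ℂ) := by
  rw [chordMoment_one, integral_chordSq_rpow_of_nonneg hd ω hβ]
  simp [chordMomentCoeff]

/-- For `β ≥ k` no factor of the recursion vanishes, so the moment divided by its conjectured
coefficient is unchanged by `β ↦ β + 1`, and can be computed in the limit. -/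
lemma chordMoment_eq_of_le {d k : ℕ} (hd : 2 ≤ d) {P : MvPolynomial (Fin d) ℂ}
    (hP : IsSolidHarmonic d k P) (ω : USphere d) {β : ℝ} (hβ : (k : ℝ) ≤ β) :
    chordMoment P ω β = (chordMomentCoeff d k β : ℂ) * sphereRestrict d P (-ω) := by
  have hd' : (2 : ℝ) ≤ d := by exact_mod_cast hd
  have hk : (0 : ℝ) ≤ k := k.cast_nonneg
  have hpos {x : ℝ} (hx : (k : ℝ) ≤ x) : (chordMomentCoeff d k x : ℂ) ≠ 0 :=
    Complex.ofReal_ne_zero.2 (chordMomentCoeff_pos hd k hx).ne'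
  have hper (n : ℕ) : chordMoment P ω (β + n) / (chordMomentCoeff d k (β + n) : ℂ) =
      chordMoment P ω β / (chordMomentCoeff d k β : ℂ) := by
    induction n with
    | zero => simp
    | succ n ih =>
      rw [← ih, Nat.cast_succ, ← add_assoc]
      have hn : (k : ℝ) ≤ β + n := by have := n.cast_nonneg (α := ℝ); linarith
      set x := β + n
      have h1 := chordMoment_recursion hd hP ω (by linarith : -(((d : ℝ) - 1) / 2) < x)
      have h2 := congrArg (fun r : ℝ => (r : ℂ))
        (chordMomentCoeff_recursion hd k (by linarith : -(((d : ℝ) - 1) / 2) < x))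
      have hA : (((x + 1) * (x + ((d : ℝ) - 1) / 2) : ℝ) : ℂ) ≠ 0 := by
        rw [Complex.ofReal_ne_zero]
        have h1 : 0 < x + 1 := by linarith
        have h2 : 0 < x + ((d : ℝ) - 1) / 2 := by linarith
        positivity
      have hB : (((x + 1 - k) * (x + k + d - 1) : ℝ) : ℂ) ≠ 0 := by
        rw [Complex.ofReal_ne_zero]
        have h1 : 0 < x + 1 - k := by linarith
        have h2 : 0 < x + k + d - 1 := by linarith
        positivity
      rw [Complex.ofReal_mul _ (chordMomentCoeff d k x),
        Complex.ofReal_mul _ (chordMomentCoeff d k (x + 1))] at h2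
      rw [← mul_div_mul_left _ (chordMomentCoeff d k (x + 1) : ℂ) hB, ← h1, ← h2,
        mul_div_mul_left _ _ hA]
  have hlim1 := (tendsto_chordMoment_div P ω (hk.trans hβ)).div
    (tendsto_chordMoment_div 1 ω (hk.trans hβ)) (by simp [sphereRestrict_one])
  have hlim2 := hlim1.mul
    ((Complex.continuous_ofReal.tendsto _).comp (tendsto_chordMomentCoeff_div hd k hβ))
  -- The invariant quotient is the moment of `P` over the moment of `1`, which tends to `P(-ω)`,
  -- times the quotient of the coefficients for `0` and `k`, which tends to `1`.
  have hconst : ∀ᶠ n : ℕ in atTop, chordMoment P ω β / (chordMomentCoeff d k β : ℂ) =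
      ((∫ θ, chordSq ω θ ^ n ∂(surfMeasure d))⁻¹ • chordMoment P ω (β + n)) /
      ((∫ θ, chordSq ω θ ^ n ∂(surfMeasure d))⁻¹ • chordMoment 1 ω (β + n)) *
      ((chordMomentCoeff d 0 (β + n) / chordMomentCoeff d k (β + n) : ℝ) : ℂ) := by
    refine Eventually.of_forall fun n => ?_
    have hn : (k : ℝ) ≤ β + n := by have := n.cast_nonneg (α := ℝ); linarith
    have hm : ∫ θ, chordSq ω θ ^ n ∂(surfMeasure d) ≠ 0 := by
      have h0 : (0 : ℝ) ≤ n := n.cast_nonneg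
      have h1 := integral_chordSq_rpow_of_nonneg hd ω h0
      simp only [Real.rpow_natCast] at h1
      rw [h1]
      have p0 := chordConst_pos d
      have p1 := Real.Gamma_pos_of_pos (by linarith : 0 < n + ((d : ℝ) - 1) / 2)
      have p2 := Real.Gamma_pos_of_pos (by linarith : 0 < n + ((d : ℝ) - 1))
      positivity
    rw [← hper n, chordMoment_one_of_nonneg hd ω ((hk.trans hn)), Complex.real_smul,
      Complex.real_smul, mul_div_mul_left _ _ (Complex.ofReal_ne_zero.2 (inv_ne_zero hm)),
      Complex.ofReal_div]
    have h0 : (chordMomentCoeff d 0 (β + n) : ℂ) ≠ 0 :=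
      Complex.ofReal_ne_zero.2 (chordMomentCoeff_pos hd 0 (by simpa using hk.trans hn)).ne'
    have := hpos hn
    field_simp
  have h := tendsto_nhds_unique (tendsto_const_nhds.congr' hconst) hlim2
  rw [div_eq_iff (hpos hβ)] at h
  rw [h]
  simp [sphereRestrict_one, mul_comm]

/-- Downward induction from `β + 1` to `β`: only the factor `β + 1` could vanish on the left of the
recursion, and a zero factor on the right does no harm. -/
lemma chordMoment_eq_of_not_int {d k : ℕ} (hd : 2 ≤ d) {P : MvPolynomial (Fin d) ℂ}
    (hP : IsSolidHarmonic d k P) (ω : USphere d) (n : ℕ) :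
    ∀ β : ℝ, -(((d : ℝ) - 1) / 2) < β → (k : ℝ) ≤ β + n → (∀ m : ℕ, β ≠ -(m + 1 : ℝ)) →
      chordMoment P ω β = (chordMomentCoeff d k β : ℂ) * sphereRestrict d P (-ω) := by
  induction n with
  | zero => exact fun β _ h _ => chordMoment_eq_of_le hd hP ω (by simpa using h)
  | succ n ih =>
    intro β h1 h2 h3
    have h := ih (β + 1) (by linarith) (by push_cast at h2; linarith) (fun m hm => by
      apply h3 (m + 1); push_cast; linarith)
    have e1 := chordMoment_recursion hd hP ω h1
    have e2 := congrArg (fun r : ℝ => (r : ℂ)) (chordMomentCoeff_recursion hd k h1)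
    rw [Complex.ofReal_mul _ (chordMomentCoeff d k β),
      Complex.ofReal_mul _ (chordMomentCoeff d k (β + 1))] at e2
    have hA : (((β + 1) * (β + ((d : ℝ) - 1) / 2) : ℝ) : ℂ) ≠ 0 := by
      rw [Complex.ofReal_ne_zero]
      have a1 : β + 1 ≠ 0 := fun h => h3 0 (by push_cast; linarith)
      have a2 : β + ((d : ℝ) - 1) / 2 ≠ 0 := by linarith
      exact mul_ne_zero a1 a2
    apply mul_left_cancel₀ hA
    rw [e1, h, ← mul_assoc, ← mul_assoc, e2]

lemma continuousAt_Gamma_comp {f : ℝ → ℝ} {x : ℝ} (hf : ContinuousAt f x) (hx : 0 < f x) :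
    ContinuousAt (fun y => Real.Gamma (f y)) x :=
  ContinuousAt.comp (g := Real.Gamma) (Real.differentiableAt_Gamma fun m => by
    have := m.cast_nonneg (α := ℝ)
    linarith).continuousAt hf

/-- The Funk–Hecke formula for powers of the distance. -/
lemma chordMoment_eq {d k : ℕ} (hd : 2 ≤ d) {P : MvPolynomial (Fin d) ℂ}
    (hP : IsSolidHarmonic d k P) (ω : USphere d) {β : ℝ} (hβ : -(((d : ℝ) - 1) / 2) < β) :
    chordMoment P ω β = (chordMomentCoeff d k β : ℂ) * sphereRestrict d P (-ω) := by
  have hd' : (2 : ℝ) ≤ d := by exact_mod_cast hd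
  have hgen : ∀ β : ℝ, -(((d : ℝ) - 1) / 2) < β → (∀ m : ℕ, β ≠ -(m + 1 : ℝ)) →
      chordMoment P ω β = (chordMomentCoeff d k β : ℂ) * sphereRestrict d P (-ω) := by
    intro β h1 h2
    obtain ⟨n, hn⟩ := exists_nat_ge (k - β)
    exact chordMoment_eq_of_not_int hd hP ω n β h1 (by linarith) h2
  by_cases hm : ∀ m : ℕ, β ≠ -(m + 1 : ℝ)
  · exact hgen β hβ hm
  push Not at hm
  obtain ⟨m, hm⟩ := hm
  -- Negative integers are approached from above. The steps `1/(n+2)` are less than `1`, so the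
  -- sequence stays strictly between consecutive integers, and `v ^ β` dominates its powers.
  have hseq : Tendsto (fun n : ℕ => β + 1 / ((n : ℝ) + 1 + 1)) atTop (𝓝 β) := by
    have := ((tendsto_one_div_add_atTop_nhds_zero_nat (𝕜 := ℝ)).comp (tendsto_add_atTop_nat 1)
      ).const_add β
    simpa [Function.comp_def] using this
  have hgt (n : ℕ) : β < β + 1 / ((n : ℝ) + 1 + 1) := by
    have : (0 : ℝ) < 1 / ((n : ℝ) + 1 + 1) := by positivity
    linarith
  have hlt (n : ℕ) : β + 1 / ((n : ℝ) + 1 + 1) < β + 1 := by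
    have : 1 / ((n : ℝ) + 1 + 1) < 1 := by
      rw [div_lt_one (by positivity)]
      have := n.cast_nonneg (α := ℝ)
      linarith
    linarith
  have hL : Tendsto (fun n : ℕ => chordMoment P ω (β + 1 / ((n : ℝ) + 1 + 1))) atTop
      (𝓝 (chordMoment P ω β)) := by
    obtain ⟨M, hM0, hM⟩ := exists_norm_sphereRestrict_le P
    refine tendsto_integral_of_dominated_convergence (fun θ => chordSq ω θ ^ β * M) (fun n => ?_)
      ((integrable_chordSq_rpow hd ω hβ).mul_const _) (fun n => ?_) ?_
    · exact (integrable_chordSq_rpow_mul hd P ω (hβ.trans (hgt n))).aestronglyMeasurable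
    · filter_upwards [ae_chordSq_pos hd ω] with θ hθ
      rw [norm_mul, Complex.norm_real, Real.norm_of_nonneg (Real.rpow_nonneg hθ.le _)]
      exact mul_le_mul (Real.rpow_le_rpow_of_exponent_ge hθ (chordSq_le_one ω θ) (hgt n).le)
        (hM θ) (norm_nonneg _) (Real.rpow_nonneg hθ.le _)
    · filter_upwards [ae_chordSq_pos hd ω] with θ hθ
      exact ((Complex.continuous_ofReal.tendsto _).comp
        (tendsto_const_nhds.rpow hseq (Or.inl hθ.ne'))).mul_const _
  have hR : ContinuousAt (chordMomentCoeff d k) β := by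
    have hk : (0 : ℝ) ≤ k := k.cast_nonneg
    have p2 : 0 < β + ((d : ℝ) - 1) + k := by linarith
    have c1 : ContinuousAt (fun β => Real.Gamma (β + ((d : ℝ) - 1) / 2)) β :=
      continuousAt_Gamma_comp (by fun_prop) (by linarith)
    have c2 : ContinuousAt (fun β => Real.Gamma (β + ((d : ℝ) - 1) + k)) β :=
      continuousAt_Gamma_comp (by fun_prop) p2
    exact ((by fun_prop : ContinuousAt
      (fun β : ℝ => chordConst d * ∏ j ∈ Finset.range k, (β - j)) β).mul c1).div c2
      (Real.Gamma_pos_of_pos p2).ne'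
  refine tendsto_nhds_unique hL (((((Complex.continuous_ofReal.tendsto _).comp
    (hR.tendsto.comp hseq)).mul_const _)).congr fun n => ?_)
  refine (hgen _ (hβ.trans (hgt n)) fun m' hm' => ?_).symm
  have h1 := hgt n
  have h2 := hlt n
  rw [hm'] at h1 h2
  have a1 : m' < m := by
    have : (m' : ℝ) < m := by linarith
    exact_mod_cast this
  have a2 : m < m' + 1 := by
    have : (m : ℝ) < m' + 1 := by linarith
    exact_mod_cast this
  omega

/-! ### Kernel operators and Schur's test -/

/-- `T` is the integral operator on `L²(μ)` with kernel `K`. -/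
def IsKernelOperator {X : Type*} [MeasurableSpace X] (μ : Measure X) (K : X → X → ℝ)
    (T : Lp ℂ 2 μ →L[ℂ] Lp ℂ 2 μ) : Prop :=
  ∀ f : Lp ℂ 2 μ, ∀ᵐ x ∂μ, Integrable (fun y => (K x y : ℂ) * f y) μ ∧
    T f x = ∫ y, (K x y : ℂ) * f y ∂μ

namespace IsKernelOperator

variable {X : Type*} [MeasurableSpace X] {μ : Measure X} {K K' : X → X → ℝ}
  {T T' : Lp ℂ 2 μ →L[ℂ] Lp ℂ 2 μ}

lemma unique (h : IsKernelOperator μ K T) (h' : IsKernelOperator μ K T') : T = T' := by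
  ext f
  filter_upwards [h f, h' f] with x hx hx'
  rw [hx.2, hx'.2]

lemma add (h : IsKernelOperator μ K T) (h' : IsKernelOperator μ K' T') :
    IsKernelOperator μ (fun x y => K x y + K' x y) (T + T') := by
  intro f
  filter_upwards [h f, h' f, Lp.coeFn_add (T f) (T' f)] with x hx hx' hs
  simp only [Complex.ofReal_add, add_mul]
  refine ⟨hx.1.add hx'.1, ?_⟩
  rw [add_apply, hs, Pi.add_apply, hx.2, hx'.2, integral_add hx.1 hx'.1]

lemma const_mul (h : IsKernelOperator μ K T) (c : ℝ) :
    IsKernelOperator μ (fun x y => c * K x y) ((c : ℂ) • T) := by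
  intro f
  filter_upwards [h f, Lp.coeFn_smul (c : ℂ) (T f)] with x hx hs
  simp only [Complex.ofReal_mul, mul_assoc]
  refine ⟨hx.1.const_mul _, ?_⟩
  rw [smul_apply, hs, Pi.smul_apply, hx.2, integral_const_mul, smul_eq_mul]

lemma sub (h : IsKernelOperator μ K T) (h' : IsKernelOperator μ K' T') :
    IsKernelOperator μ (fun x y => K x y - K' x y) (T - T') := by
  have := h.add (h'.const_mul (-1))
  simpa [sub_eq_add_neg] using this

end IsKernelOperator

/-- Cauchy-Schwarz after splitting `k g` as `k ^ (1/2) * (k ^ (1/2) g)`. -/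
lemma sq_lintegral_mul_le {X : Type*} [MeasurableSpace X] {μ : Measure X} {k g : X → ENNReal}
    (hk : Measurable k) (hg : Measurable g) :
    (∫⁻ y, k y * g y ∂μ) ^ 2 ≤ (∫⁻ y, k y ∂μ) * ∫⁻ y, k y * g y ^ 2 ∂μ := by
  have h := ENNReal.lintegral_mul_le_Lp_mul_Lq μ Real.HolderConjugate.two_two
    (f := fun y => k y ^ (1 / 2 : ℝ)) (g := fun y => k y ^ (1 / 2 : ℝ) * g y)
    (hk.pow_const _).aemeasurable ((hk.pow_const _).mul hg).aemeasurable
  have e0 (a : ENNReal) : (a ^ (1 / 2 : ℝ)) ^ (2 : ℝ) = a := by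
    rw [← ENNReal.rpow_mul]; norm_num
  have e1 (a : ENNReal) : a ^ (1 / 2 : ℝ) * a ^ (1 / 2 : ℝ) = a := by
    rw [← ENNReal.rpow_add_of_nonneg _ _ (by norm_num) (by norm_num)]; norm_num
  simp only [Pi.mul_apply, ← mul_assoc, e1, ENNReal.mul_rpow_of_nonneg _ _ zero_le_two, e0] at h
  calc (∫⁻ y, k y * g y ∂μ) ^ 2 ≤ ((∫⁻ y, k y ∂μ) ^ (1 / 2 : ℝ) *
        (∫⁻ y, k y * g y ^ (2 : ℝ) ∂μ) ^ (1 / 2 : ℝ)) ^ 2 := by gcongr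
    _ = _ := by
      rw [← ENNReal.rpow_natCast, ENNReal.mul_rpow_of_nonneg _ _ (by norm_num), Nat.cast_ofNat,
        e0, e0]
      simp

/-- **Schur's test**, with the same bound for the rows and the columns. -/
lemma exists_isKernelOperator {X : Type*} [MeasurableSpace X] {μ : Measure X} [SFinite μ]
    {K : X → X → ℝ} (hK : Measurable (Function.uncurry K)) {M : ℝ} (hM : 0 ≤ M)
    (h1 : ∀ x, ∫⁻ y, ‖K x y‖ₑ ∂μ ≤ ENNReal.ofReal M)
    (h2 : ∀ y, ∫⁻ x, ‖K x y‖ₑ ∂μ ≤ ENNReal.ofReal M) :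
    ∃ T : Lp ℂ 2 μ →L[ℂ] Lp ℂ 2 μ, ‖T‖ ≤ M ∧ IsKernelOperator μ K T := by
  set M' := ENNReal.ofReal M with hM'
  have hKx (x : X) : Measurable (K x) := hK.comp measurable_prodMk_left
  have hke : Measurable fun p : X × X => ‖K p.1 p.2‖ₑ := hK.enorm
  have hfm (f : Lp ℂ 2 μ) : Measurable fun y => ‖f y‖ₑ := (Lp.stronglyMeasurable f).measurable.enorm
  have hmeas (f : Lp ℂ 2 μ) : StronglyMeasurable fun x => ∫ y, (K x y : ℂ) * f y ∂μ := by
    refine StronglyMeasurable.integral_prod_right (f := fun x y => (K x y : ℂ) * f y) ?_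
    exact ((Complex.measurable_ofReal.comp hK).stronglyMeasurable).mul
      ((Lp.stronglyMeasurable f).comp_measurable measurable_snd)
  -- The row bound supplies one factor `M'` after Cauchy-Schwarz, the column bound the other after
  -- Tonelli.
  have hsq (f : Lp ℂ 2 μ) : ∫⁻ x, (∫⁻ y, ‖K x y‖ₑ * ‖f y‖ₑ ∂μ) ^ 2 ∂μ ≤
      M' ^ 2 * ∫⁻ y, ‖f y‖ₑ ^ 2 ∂μ := by
    calc ∫⁻ x, (∫⁻ y, ‖K x y‖ₑ * ‖f y‖ₑ ∂μ) ^ 2 ∂μ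
        ≤ ∫⁻ x, M' * ∫⁻ y, ‖K x y‖ₑ * ‖f y‖ₑ ^ 2 ∂μ ∂μ := by
          refine lintegral_mono fun x => (sq_lintegral_mul_le (hKx x).enorm (hfm f)).trans ?_
          gcongr
          exact h1 x
      _ = M' * ∫⁻ y, ∫⁻ x, ‖K x y‖ₑ * ‖f y‖ₑ ^ 2 ∂μ ∂μ := by
          have hm : Measurable fun p : X × X => ‖K p.1 p.2‖ₑ * ‖f p.2‖ₑ ^ 2 :=
            hke.mul (((hfm f).comp measurable_snd).pow_const 2)
          rw [lintegral_const_mul _ hm.lintegral_prod_right',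
            lintegral_lintegral_swap hm.aemeasurable]
      _ ≤ M' * ∫⁻ y, M' * ‖f y‖ₑ ^ 2 ∂μ := by
          gcongr with y
          have hm : Measurable fun x => ‖K x y‖ₑ := hke.comp measurable_prodMk_right
          rw [lintegral_mul_const _ hm]
          gcongr
          exact h2 y
      _ = M' ^ 2 * ∫⁻ y, ‖f y‖ₑ ^ 2 ∂μ := by
          rw [lintegral_const_mul _ ((hfm f).pow_const 2), ← mul_assoc, sq]
  have hnorm (g : X → ℂ) : eLpNorm g 2 μ ^ 2 = ∫⁻ y, ‖g y‖ₑ ^ 2 ∂μ := by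
    rw [eLpNorm_eq_lintegral_rpow_enorm_toReal two_ne_zero ENNReal.ofNat_ne_top,
      ← ENNReal.rpow_natCast, ← ENNReal.rpow_mul]
    simp
  have hnormT (f : Lp ℂ 2 μ) : eLpNorm (fun x => ∫ y, (K x y : ℂ) * f y ∂μ) 2 μ ≤
      M' * eLpNorm f 2 μ := by
    rw [← ENNReal.pow_le_pow_left_iff two_ne_zero, mul_pow, hnorm, hnorm]
    refine (lintegral_mono fun x => ?_).trans (hsq f)
    gcongr
    refine (enorm_integral_le_lintegral_enorm _).trans_eq (lintegral_congr fun y => ?_)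
    rw [enorm_mul]
    simp [enorm, nnnorm]
  have hint (f : Lp ℂ 2 μ) : ∀ᵐ x ∂μ, Integrable (fun y => (K x y : ℂ) * f y) μ := by
    have hfin : ∫⁻ x, (∫⁻ y, ‖K x y‖ₑ * ‖f y‖ₑ ∂μ) ^ 2 ∂μ ≠ ⊤ := by
      refine ((hsq f).trans_lt (ENNReal.mul_lt_top (by simp [hM']) ?_)).ne
      rw [← hnorm]
      exact ENNReal.pow_lt_top (Lp.eLpNorm_lt_top f)
    have hm : Measurable fun p : X × X => ‖K p.1 p.2‖ₑ * ‖f p.2‖ₑ :=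
      hke.mul ((hfm f).comp measurable_snd)
    filter_upwards [ae_lt_top (hm.lintegral_prod_right'.pow_const 2) hfin] with x hx
    refine ⟨((Complex.measurable_ofReal.comp (hKx x)).mul
      (Lp.stronglyMeasurable f).measurable).aestronglyMeasurable, ?_⟩
    rw [hasFiniteIntegral_iff_enorm]
    refine lt_of_eq_of_lt (lintegral_congr fun y => ?_)
      ((ENNReal.pow_lt_top_iff).1 hx |>.resolve_right two_ne_zero)
    rw [enorm_mul]
    simp [enorm, nnnorm]
  have hmem (f : Lp ℂ 2 μ) : MemLp (fun x => ∫ y, (K x y : ℂ) * f y ∂μ) 2 μ :=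
    ⟨(hmeas f).aestronglyMeasurable, (hnormT f).trans_lt
      (ENNReal.mul_lt_top (by simp [hM']) (Lp.eLpNorm_lt_top f))⟩
  let L : Lp ℂ 2 μ →ₗ[ℂ] Lp ℂ 2 μ :=
    { toFun := fun f => (hmem f).toLp
      map_add' := fun f g => by
        ext
        filter_upwards [(hmem f).coeFn_toLp, (hmem g).coeFn_toLp, (hmem (f + g)).coeFn_toLp,
          Lp.coeFn_add (hmem f).toLp (hmem g).toLp, hint f, hint g] with x e1 e2 e3 e4 i1 i2
        rw [e4, e3, Pi.add_apply, e1, e2, ← integral_add i1 i2]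
        refine integral_congr_ae ?_
        filter_upwards [Lp.coeFn_add f g] with y hy
        rw [hy, Pi.add_apply, mul_add]
      map_smul' := fun c f => by
        ext
        filter_upwards [(hmem f).coeFn_toLp, (hmem (c • f)).coeFn_toLp,
          Lp.coeFn_smul c (hmem f).toLp] with x e1 e3 e4
        rw [RingHom.id_apply, e4, e3, Pi.smul_apply, e1, smul_eq_mul, ← integral_const_mul]
        refine integral_congr_ae ?_
        filter_upwards [Lp.coeFn_smul c f] with y hy
        rw [hy, Pi.smul_apply, smul_eq_mul]
        ring }
  have hL (f : Lp ℂ 2 μ) : ‖L f‖ ≤ M * ‖f‖ := by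
    change ‖(hmem f).toLp‖ ≤ _
    rw [Lp.norm_toLp, Lp.norm_def, ← ENNReal.toReal_ofReal hM, ← ENNReal.toReal_mul]
    exact ENNReal.toReal_mono (ENNReal.mul_ne_top (by simp) (Lp.eLpNorm_ne_top f)) (hnormT f)
  refine ⟨L.mkContinuous M hL, L.mkContinuous_norm_le hM hL, fun f => ?_⟩
  filter_upwards [hint f, (hmem f).coeFn_toLp] with x hx hx'
  exact ⟨hx, hx'⟩

lemma IsKernelOperator.norm_le {X : Type*} [MeasurableSpace X] {μ : Measure X} [SFinite μ]
    {K : X → X → ℝ} {T : Lp ℂ 2 μ →L[ℂ] Lp ℂ 2 μ} (hT : IsKernelOperator μ K T)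
    (hK : Measurable (Function.uncurry K)) {M : ℝ} (hM : 0 ≤ M)
    (h1 : ∀ x, ∫⁻ y, ‖K x y‖ₑ ∂μ ≤ ENNReal.ofReal M)
    (h2 : ∀ y, ∫⁻ x, ‖K x y‖ₑ ∂μ ≤ ENNReal.ofReal M) : ‖T‖ ≤ M := by
  obtain ⟨T', hT', h⟩ := exists_isKernelOperator hK hM h1 h2
  rwa [hT.unique h]

/-! ### Compactness by finite-rank approximation -/

/-- The kernels of compact operators. -/
def IsCompactKernel {X : Type*} [MeasurableSpace X] (μ : Measure X) (K : X → X → ℝ) : Prop :=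
  ∃ T : Lp ℂ 2 μ →L[ℂ] Lp ℂ 2 μ, IsCompactOperator T ∧ IsKernelOperator μ K T

namespace IsCompactKernel

variable {X : Type*} [MeasurableSpace X] {μ : Measure X}

lemma const_mul {K : X → X → ℝ} (h : IsCompactKernel μ K) (c : ℝ) :
    IsCompactKernel μ fun x y => c * K x y := by
  obtain ⟨T, hc, hT⟩ := h
  exact ⟨(c : ℂ) • T, hc.smul (c : ℂ), hT.const_mul c⟩

lemma sum {ι : Type*} (s : Finset ι) {K : ι → X → X → ℝ} (h : ∀ i ∈ s, IsCompactKernel μ (K i)) :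
    IsCompactKernel μ fun x y => ∑ i ∈ s, K i x y := by
  classical
  induction s using Finset.induction_on with
  | empty =>
    refine ⟨0, isCompactOperator_zero, fun f => ?_⟩
    filter_upwards [Lp.coeFn_zero ℂ 2 μ] with x hx
    have h0 : (0 : Lp ℂ 2 μ →L[ℂ] Lp ℂ 2 μ) f = 0 := rfl
    rw [h0, hx]
    simp
  | insert i s his ih =>
    obtain ⟨T, hc, hT⟩ := h i (Finset.mem_insert_self i s)
    obtain ⟨T', hc', hT'⟩ := ih fun j hj => h j (Finset.mem_insert_of_mem hj)
    simp only [Finset.sum_insert his]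
    exact ⟨T + T', hc.add hc', hT.add hT'⟩

lemma mul_apply [TopologicalSpace X] [CompactSpace X] [BorelSpace X]
    [IsFiniteMeasure μ] {a b : X → ℝ} (ha : Continuous a) (hb : Continuous b) :
    IsCompactKernel μ fun x y => a x * b y := by
  let A : C(X, ℂ) := ⟨fun x => (a x : ℂ), by fun_prop⟩
  let B : C(X, ℂ) := ⟨fun x => (b x : ℂ), by fun_prop⟩
  let A' := ContinuousMap.toLp 2 μ ℂ A
  let B' := ContinuousMap.toLp 2 μ ℂ B
  refine ⟨(innerSL ℂ B').smulRight A', ?_, fun f => ?_⟩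
  · exact (isCompactOperator_of_locallyCompactSpace_dom (innerSL ℂ B')).clm_comp
      (ContinuousLinearMap.toSpanSingleton ℂ A')
  · have hBf : Integrable (fun y => (b y : ℂ) * f y) μ := by
      obtain ⟨M, hM⟩ := (isCompact_range B.continuous).isBounded.exists_norm_le
      refine Integrable.bdd_mul (c := M) ((Lp.memLp f).integrable one_le_two)
        B.continuous.aestronglyMeasurable (Eventually.of_forall fun y => hM _ ⟨y, rfl⟩)
    have hin : inner ℂ B' f = ∫ y, (b y : ℂ) * f y ∂μ := by
      rw [L2.inner_def]
      refine integral_congr_ae ?_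
      filter_upwards [ContinuousMap.coeFn_toLp μ (𝕜 := ℂ) (p := 2) B] with y hy
      rw [hy]
      simp [B, mul_comm]
    filter_upwards [ContinuousMap.coeFn_toLp μ (𝕜 := ℂ) (p := 2) A,
      Lp.coeFn_smul (inner ℂ B' f) A'] with x hx hs
    simp only [Complex.ofReal_mul, mul_assoc]
    refine ⟨hBf.const_mul _, ?_⟩
    rw [integral_const_mul, ← hin, ContinuousLinearMap.smulRight_apply, innerSL_apply_apply, hs,
      Pi.smul_apply, hx, smul_eq_mul, mul_comm]
    rfl

end IsCompactKernel

/-- Expanding `(∑ ω_l θ_l) ^ n` gives finitely many rank-one kernels. -/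
lemma isCompactKernel_sphereCos_pow (d n : ℕ) :
    IsCompactKernel (surfMeasure d) fun ω θ => sphereCos ω θ ^ n := by
  simp only [sphereCos_eq_sum, Fintype.sum_pow, Finset.prod_mul_distrib]
  refine IsCompactKernel.sum _ fun p _ => IsCompactKernel.mul_apply ?_ ?_ <;> fun_prop

lemma isCompactKernel_polynomial_sphereCos (d : ℕ) (p : Polynomial ℝ) :
    IsCompactKernel (surfMeasure d) fun ω θ => p.eval (sphereCos ω θ) := by
  simp only [Polynomial.eval_eq_sum_range]
  exact IsCompactKernel.sum _ fun n _ => (isCompactKernel_sphereCos_pow d n).const_mul _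

lemma integral_chordSq_rpow {d : ℕ} (hd : 2 ≤ d) (ω : USphere d) {β : ℝ}
    (hβ : -(((d : ℝ) - 1) / 2) < β) :
    ∫ θ, chordSq ω θ ^ β ∂(surfMeasure d) = chordMomentCoeff d 0 β := by
  have h := chordMoment_eq hd (isSolidHarmonic_one d) ω hβ
  rw [chordMoment_one, sphereRestrict_one, mul_one] at h
  exact_mod_cast h

lemma lintegral_enorm_chordSq_rpow {d : ℕ} (hd : 2 ≤ d) (ω : USphere d) {β : ℝ}
    (hβ : -(((d : ℝ) - 1) / 2) < β) :
    ∫⁻ θ, ‖chordSq ω θ ^ β‖ₑ ∂(surfMeasure d) = ENNReal.ofReal (chordMomentCoeff d 0 β) := by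
  rw [← integral_chordSq_rpow hd ω hβ, ofReal_integral_eq_lintegral_ofReal
    (integrable_chordSq_rpow hd ω hβ)
    (Eventually.of_forall fun θ => Real.rpow_nonneg (chordSq_nonneg ω θ) _)]
  exact lintegral_congr fun θ => Real.enorm_of_nonneg (Real.rpow_nonneg (chordSq_nonneg ω θ) _)

lemma measurable_chordSq_rpow_uncurry (d : ℕ) (β : ℝ) :
    Measurable (Function.uncurry fun ω θ : USphere d => chordSq ω θ ^ β) :=
  (continuous_chordSq_uncurry.measurable).pow_const β

lemma chordMomentCoeff_zero_nonneg {d : ℕ} (hd : 2 ≤ d) {β : ℝ}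
    (hβ : -(((d : ℝ) - 1) / 2) < β) : 0 ≤ chordMomentCoeff d 0 β := by
  have hω : Nonempty (Fin d) := ⟨⟨0, by omega⟩⟩
  obtain ⟨i⟩ := hω
  rw [← integral_chordSq_rpow hd ⟨EuclideanSpace.single i 1, by simp⟩ hβ]
  exact integral_nonneg fun θ => Real.rpow_nonneg (chordSq_nonneg _ θ) _

lemma exists_chordSq_rpow_operator {d : ℕ} (hd : 2 ≤ d) {β : ℝ}
    (hβ : -(((d : ℝ) - 1) / 2) < β) :
    ∃ T : L2Sphere d →L[ℂ] L2Sphere d, ‖T‖ ≤ chordMomentCoeff d 0 β ∧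
      IsKernelOperator (surfMeasure d) (fun ω θ => chordSq ω θ ^ β) T := by
  refine exists_isKernelOperator (measurable_chordSq_rpow_uncurry d β)
    (chordMomentCoeff_zero_nonneg hd hβ)
    (fun ω => (lintegral_enorm_chordSq_rpow hd ω hβ).le) (fun θ => ?_)
  simp only [chordSq_comm _ θ]
  exact (lintegral_enorm_chordSq_rpow hd θ hβ).le

/-- A quantitative polynomial approximation of a singular power. -/
lemma exists_polynomial_near_rpow {β η δ : ℝ} (hβ : β < 0) (hη : 0 < η) (hδ : 0 < δ) :
    ∃ p : Polynomial ℝ, ∀ t ∈ Set.Icc (-1 : ℝ) 1, 0 < (1 - t) / 2 →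
      |((1 - t) / 2) ^ β - p.eval t| ≤ δ ^ η * ((1 - t) / 2) ^ (β - η) + δ := by
  -- Weierstrass is applied to the power truncated at `v = δ`. Where `v ≤ δ` the truncation error is
  -- at most `v ^ β = v ^ η v ^ (β - η) ≤ δ ^ η v ^ (β - η)`.
  have hc : Continuous fun t : ℝ => (max ((1 - t) / 2) δ) ^ β :=
    (by fun_prop : Continuous fun t : ℝ => max ((1 - t) / 2) δ).rpow_const
      fun t => Or.inl (lt_max_of_lt_right hδ).ne'
  obtain ⟨p, hp⟩ := exists_polynomial_near_of_continuousOn (-1) 1 _ hc.continuousOn δ hδ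
  refine ⟨p, fun t ht hv => ?_⟩
  have h1 := hp t ht
  rw [abs_sub_comm] at h1
  set v := (1 - t) / 2
  have h2 : |v ^ β - (max v δ) ^ β| ≤ δ ^ η * v ^ (β - η) := by
    rcases le_total δ v with h | h
    · rw [max_eq_left h, sub_self, abs_zero]
      positivity
    · rw [max_eq_right h]
      have a1 := Real.rpow_le_rpow_of_nonpos hv h hβ.le
      rw [abs_of_nonneg (sub_nonneg.2 a1)]
      have a2 : v ^ β = v ^ η * v ^ (β - η) := by rw [← Real.rpow_add hv]; ring_nf
      have a3 : v ^ η ≤ δ ^ η := Real.rpow_le_rpow hv.le h hη.le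
      have a4 : 0 < δ ^ β := Real.rpow_pos_of_pos hδ β
      have a5 := mul_le_mul_of_nonneg_right a3 (Real.rpow_nonneg hv.le (β - η))
      linarith
  calc |v ^ β - p.eval t| ≤ |v ^ β - (max v δ) ^ β| + |(max v δ) ^ β - p.eval t| := abs_sub_le _ _ _
    _ ≤ _ := by linarith

lemma isCompactOperator_chordSq_rpow {d : ℕ} (hd : 2 ≤ d) {β : ℝ}
    (hβ : -(((d : ℝ) - 1) / 2) < β) (hβ0 : β < 0) {T : L2Sphere d →L[ℂ] L2Sphere d}
    (hT : IsKernelOperator (surfMeasure d) (fun ω θ => chordSq ω θ ^ β) T) :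
    IsCompactOperator T := by
  -- There is room below `β` in the integrable range: the error kernel is at most `δ ^ η v ^ γ + δ`,
  -- whose row integrals tend to `0` with `δ`.
  obtain ⟨γ, hγ, hγβ⟩ := exists_between hβ
  set η := β - γ with hη
  have hη0 : 0 < η := sub_pos.2 hγβ
  set A := chordMomentCoeff d 0 γ
  have hA : 0 ≤ A := chordMomentCoeff_zero_nonneg hd hγ
  set S := (surfMeasure d).real Set.univ
  have key (n : ℕ) : ∃ T' : L2Sphere d →L[ℂ] L2Sphere d, IsCompactOperator T' ∧
      ‖T - T'‖ ≤ (1 / ((n : ℝ) + 1)) ^ η * A + 1 / ((n : ℝ) + 1) * S := by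
    set δ : ℝ := 1 / ((n : ℝ) + 1)
    have hδ : 0 < δ := (one_div_nat_add_one_mem n).1
    obtain ⟨p, hp⟩ := exists_polynomial_near_rpow hβ0 hη0 hδ
    obtain ⟨T', hT'c, hT'⟩ := isCompactKernel_polynomial_sphereCos d p
    refine ⟨T', hT'c, ?_⟩
    have hrow (ω : USphere d) : ∫⁻ θ, ‖chordSq ω θ ^ β - p.eval (sphereCos ω θ)‖ₑ ∂(surfMeasure d) ≤
        ENNReal.ofReal (δ ^ η * A + δ * S) := by
      have hint := ((integrable_chordSq_rpow hd ω hγ).const_mul (δ ^ η)).add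
        (integrable_const (μ := surfMeasure d) δ)
      calc ∫⁻ θ, ‖chordSq ω θ ^ β - p.eval (sphereCos ω θ)‖ₑ ∂(surfMeasure d)
          ≤ ∫⁻ θ, ENNReal.ofReal (δ ^ η * chordSq ω θ ^ γ + δ) ∂(surfMeasure d) := by
            refine lintegral_mono_ae ?_
            filter_upwards [ae_chordSq_pos hd ω] with θ hθ
            have h := hp _ (sphereCos_mem_Icc ω θ) hθ
            rw [show β - η = γ by simp [hη]] at h
            rw [← ofReal_norm]
            exact ENNReal.ofReal_le_ofReal h
        _ = ENNReal.ofReal (∫ θ, (δ ^ η * chordSq ω θ ^ γ + δ) ∂(surfMeasure d)) := by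
            refine (ofReal_integral_eq_lintegral_ofReal hint
              (Eventually.of_forall fun θ => ?_)).symm
            exact add_nonneg (mul_nonneg (by positivity)
              (Real.rpow_nonneg (chordSq_nonneg ω θ) _)) hδ.le
        _ = _ := by
            rw [integral_add ((integrable_chordSq_rpow hd ω hγ).const_mul (δ ^ η))
              (integrable_const _), integral_const_mul, integral_chordSq_rpow hd ω hγ,
              integral_const, smul_eq_mul, mul_comm S]
    refine (hT.sub hT').norm_le ?_ (by positivity) hrow fun θ => ?_
    · refine (measurable_chordSq_rpow_uncurry d β).sub (Continuous.measurable ?_)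
      have : Continuous fun x : USphere d × USphere d => sphereCos x.1 x.2 := by
        unfold sphereCos; fun_prop
      exact p.continuous.comp this
    · have hcos (ω : USphere d) : sphereCos ω θ = sphereCos θ ω := by
        simp [sphereCos, real_inner_comm]
      simp only [chordSq_comm _ θ, hcos]
      exact hrow θ
  choose T' hT'c hT'n using key
  have hlim : Tendsto (fun n : ℕ => (1 / ((n : ℝ) + 1)) ^ η * A + 1 / ((n : ℝ) + 1) * S) atTop
      (𝓝 0) := by
    have h1 := tendsto_one_div_add_atTop_nhds_zero_nat (𝕜 := ℝ)
    have h2 := ((h1.rpow_const (p := η) (Or.inr hη0.le)).mul_const A).add (h1.mul_const S)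
    simpa [Real.zero_rpow hη0.ne'] using h2
  refine isCompactOperator_of_tendsto (l := atTop) (F := T') ?_ (Eventually.of_forall hT'c)
  rw [tendsto_iff_norm_sub_tendsto_zero]
  refine squeeze_zero (fun n => norm_nonneg _) (fun n => ?_) hlim
  rw [norm_sub_rev]
  exact hT'n n

/-! ### The eigenvalues -/

lemma Gamma_eq_prod_mul_Gamma_sub {x : ℝ} (hx1 : x < 1) (k : ℕ) :
    Real.Gamma x = (∏ j ∈ Finset.range k, (x - ((j : ℝ) + 1))) * Real.Gamma (x - k) := by
  induction k with
  | zero => simp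
  | succ k ih =>
    have hk : (0 : ℝ) ≤ k := k.cast_nonneg
    have h := Real.Gamma_add_one (by linarith : x - ((k : ℝ) + 1) ≠ 0)
    rw [show x - ((k : ℝ) + 1) + 1 = x - k by ring] at h
    rw [ih, Finset.prod_range_succ, h, Nat.cast_succ]
    ring

lemma eigenVal_eq_eigenGamma {d : ℕ} {a : ℝ} (ha₁ : 1 - (d : ℝ) / 2 < a) (k : ℕ)
    (h : ∀ m : ℕ, 2 - a - (d : ℝ) / 2 ≠ -(m : ℝ)) : eigenVal d a k = eigenGamma d a k := by
  have hx := Gamma_eq_prod_mul_Gamma_sub (by linarith : 2 - a - (d : ℝ) / 2 < 1) k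
  -- A pole `x - k = -m` with `m < k` would make `x = 2 - a - d/2` a positive integer, against `x <
  -- 1`; with `m ≥ k` it would make `x` itself a pole.
  have hne : Real.Gamma (2 - a - (d : ℝ) / 2 - k) ≠ 0 := Real.Gamma_ne_zero fun m hm => by
    rcases lt_or_ge m k with hmk | hmk
    · obtain ⟨n, rfl⟩ := Nat.exists_eq_add_of_lt hmk
      push_cast at hm
      have := n.cast_nonneg (α := ℝ)
      linarith
    · apply h (m - k)
      rw [Nat.cast_sub hmk]
      linarith
  rw [eigenVal, eigenGamma, hx, ← mul_assoc, mul_comm (Real.Gamma (2 - a - (d : ℝ) / 2 - k)),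
    mul_div_mul_right _ _ hne]

lemma eventually_ne_neg_natCast (x : ℝ) : ∀ᶠ y in 𝓝[≠] x, ∀ m : ℕ, y ≠ -(m : ℝ) := by
  -- This interval around `x` contains no integer other than possibly `x`.
  have hmem : Set.Ioo ((⌈x⌉ : ℝ) - 1) (⌊x⌋ + 1) ∈ 𝓝[≠] x :=
    mem_nhdsWithin_of_mem_nhds (Ioo_mem_nhds (by linarith [Int.ceil_lt_add_one x])
      (Int.lt_floor_add_one x))
  filter_upwards [hmem, self_mem_nhdsWithin] with y hy hyx m hm
  apply hyx
  have h1 : ⌈x⌉ - 1 < -(m : ℤ) := by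
    have := hy.1
    rw [hm] at this
    exact_mod_cast this
  have h2 : -(m : ℤ) < ⌊x⌋ + 1 := by
    have := hy.2
    rw [hm] at this
    exact_mod_cast this
  have h3 : (⌈x⌉ : ℝ) ≤ -(m : ℝ) := by
    have : ⌈x⌉ ≤ -(m : ℤ) := by omega
    exact_mod_cast this
  have h4 : -(m : ℝ) ≤ ⌊x⌋ := by
    have : -(m : ℤ) ≤ ⌊x⌋ := by omega
    exact_mod_cast this
  have h5 := Int.le_ceil x
  have h6 := Int.floor_le x
  simp only [Set.mem_singleton_iff]
  linarith

lemma continuousAt_eigenVal {d : ℕ} (hd : 2 ≤ d) {a : ℝ} (ha₂ : a < 1 / 2) (k : ℕ) :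
    ContinuousAt (fun b => eigenVal d b k) a := by
  have hd' : (2 : ℝ) ≤ d := by exact_mod_cast hd
  have hk : (0 : ℝ) ≤ k := k.cast_nonneg
  have p : 0 < -a + (d : ℝ) / 2 + k := by linarith
  have c1 : ContinuousAt (fun b : ℝ => Real.Gamma (1 / 2 - b)) a :=
    continuousAt_Gamma_comp (by fun_prop) (by linarith)
  have c2 : ContinuousAt (fun b : ℝ => Real.Gamma (-b + (d : ℝ) / 2 + k)) a :=
    continuousAt_Gamma_comp (by fun_prop) p
  have c3 : ContinuousAt (fun b : ℝ => (2 : ℝ) ^ (2 * b)) a :=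
    continuousAt_const.rpow (by fun_prop) (Or.inl two_ne_zero)
  unfold eigenVal
  exact (continuousAt_const.div c3 (by positivity)).mul
    (((continuousAt_const.mul c1).mul (by fun_prop)).div c2 (Real.Gamma_pos_of_pos p).ne')

lemma tendsto_eigenGamma {d : ℕ} (hd : 2 ≤ d) {a : ℝ} (ha₁ : 1 - (d : ℝ) / 2 < a)
    (ha₂ : a < 1 / 2) (k : ℕ) :
    Tendsto (fun b : ℝ => eigenGamma d b k) (𝓝[≠] a) (𝓝 (eigenVal d a k)) := by
  refine ((continuousAt_eigenVal hd ha₂ k).tendsto.mono_left nhdsWithin_le_nhds).congr' ?_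
  have hmap : Tendsto (fun b : ℝ => 2 - b - (d : ℝ) / 2) (𝓝[≠] a) (𝓝[≠] (2 - a - (d : ℝ) / 2)) := by
    refine tendsto_nhdsWithin_of_tendsto_nhds_of_eventually_within _
      (((by fun_prop : Continuous fun b : ℝ => 2 - b - (d : ℝ) / 2).tendsto a).mono_left
        nhdsWithin_le_nhds) ?_
    filter_upwards [self_mem_nhdsWithin] with b hb h
    apply hb
    simp only [Set.mem_singleton_iff] at h ⊢
    linarith
  filter_upwards [hmap.eventually (eventually_ne_neg_natCast _),
    mem_nhdsWithin_of_mem_nhds (Ioi_mem_nhds ha₁)] with b hb hb1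
  exact eigenVal_eq_eigenGamma hb1 k hb

lemma eigenVal_succ {d : ℕ} (hd : 2 ≤ d) {a : ℝ} (ha₂ : a < 1 / 2) (k : ℕ) :
    eigenVal d a (k + 1) =
      (a + (d : ℝ) / 2 - 1 + k) / (-a + (d : ℝ) / 2 + k) * eigenVal d a k := by
  have hd' : (2 : ℝ) ≤ d := by exact_mod_cast hd
  have p : 0 < -a + (d : ℝ) / 2 + k := by have := k.cast_nonneg (α := ℝ); linarith
  have hG := Real.Gamma_pos_of_pos p
  rw [eigenVal, eigenVal, Finset.prod_range_succ, Nat.cast_succ, ← add_assoc,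
    Real.Gamma_add_one p.ne', pow_succ]
  generalize Real.Gamma (-a + (d : ℝ) / 2 + k) = G at hG ⊢
  generalize -a + (d : ℝ) / 2 + k = q at p ⊢
  field_simp
  ring

lemma eigenVal_pos {d : ℕ} (hd : 2 ≤ d) {a : ℝ} (ha₁ : 1 - (d : ℝ) / 2 < a) (ha₂ : a < 1 / 2)
    (k : ℕ) : 0 < eigenVal d a k := by
  have hd' : (2 : ℝ) ≤ d := by exact_mod_cast hd
  induction k with
  | zero =>
    have p1 := Real.Gamma_pos_of_pos (by linarith : 0 < 1 / 2 - a)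
    have p2 := Real.Gamma_pos_of_pos (by linarith : 0 < -a + (d : ℝ) / 2)
    simp only [eigenVal, pow_zero, Finset.range_zero, Finset.prod_empty, CharP.cast_eq_zero,
      add_zero]
    positivity
  | succ k ih =>
    rw [eigenVal_succ hd ha₂]
    have := k.cast_nonneg (α := ℝ)
    exact mul_pos (div_pos (by linarith) (by linarith)) ih

lemma strictAnti_eigenVal {d : ℕ} (hd : 2 ≤ d) {a : ℝ} (ha₁ : 1 - (d : ℝ) / 2 < a)
    (ha₂ : a < 1 / 2) : StrictAnti (eigenVal d a) := by
  have hd' : (2 : ℝ) ≤ d := by exact_mod_cast hd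
  refine strictAnti_nat_of_succ_lt fun k => ?_
  have := k.cast_nonneg (α := ℝ)
  rw [eigenVal_succ hd ha₂]
  refine mul_lt_of_lt_one_left (eigenVal_pos hd ha₁ ha₂ k) ?_
  rw [div_lt_one (by linarith)]
  linarith

lemma tendsto_eigenVal {d : ℕ} (hd : 2 ≤ d) {a : ℝ} (ha₁ : 1 - (d : ℝ) / 2 < a)
    (ha₂ : a < 1 / 2) : Tendsto (eigenVal d a) atTop (𝓝 0) := by
  have hd' : (2 : ℝ) ≤ d := by exact_mod_cast hd
  set b : ℝ := -a + (d : ℝ) / 2 with hb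
  have hb0 : 0 < b := by simp only [hb]; linarith
  -- The ratio of consecutive eigenvalues is `1 - (1-2a)/(b+k)`. Since `b + k ≤ (b+1)(k+1)`, it is
  -- at most `1 - r/(k+1) ≤ exp(-r/(k+1))`.
  set r : ℝ := (1 - 2 * a) / (b + 1) with hr
  have hr0 : 0 < r := div_pos (by linarith) (by linarith)
  have hbound (k : ℕ) : eigenVal d a k ≤
      eigenVal d a 0 * Real.exp (-(r * ∑ i ∈ Finset.range k, 1 / ((i : ℝ) + 1))) := by
    induction k with
    | zero => simp
    | succ k ih =>
      have hk := k.cast_nonneg (α := ℝ)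
      have hbk : 0 < b + k := by linarith
      have h1 : (a + (d : ℝ) / 2 - 1 + k) / (-a + (d : ℝ) / 2 + k) ≤
          Real.exp (-(r * (1 / ((k : ℝ) + 1)))) := by
        refine le_trans ?_ (Real.add_one_le_exp _)
        rw [← hb, div_le_iff₀ hbk]
        have h2 : r * (1 / ((k : ℝ) + 1)) * (b + k) ≤ 1 - 2 * a := by
          have : (b + k) / ((b + 1) * ((k : ℝ) + 1)) ≤ 1 := by
            rw [div_le_one (by positivity)]
            nlinarith
          calc r * (1 / ((k : ℝ) + 1)) * (b + k)
              = (1 - 2 * a) * ((b + k) / ((b + 1) * ((k : ℝ) + 1))) := by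
                rw [hr]; field_simp
            _ ≤ (1 - 2 * a) * 1 := mul_le_mul_of_nonneg_left this (by linarith)
            _ = _ := mul_one _
        have h3 : a + (d : ℝ) / 2 - 1 + k = b + k - (1 - 2 * a) := by simp only [hb]; ring
        rw [h3]
        linarith
      rw [eigenVal_succ hd ha₂, Finset.sum_range_succ, mul_add, neg_add, Real.exp_add]
      calc _ ≤ Real.exp (-(r * (1 / ((k : ℝ) + 1)))) * (eigenVal d a 0 *
            Real.exp (-(r * ∑ i ∈ Finset.range k, 1 / ((i : ℝ) + 1)))) :=
            mul_le_mul h1 ih (eigenVal_pos hd ha₁ ha₂ k).le (Real.exp_pos _).le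
        _ = _ := by ring
  refine squeeze_zero (fun k => (eigenVal_pos hd ha₁ ha₂ k).le) hbound ?_
  have h := (Real.tendsto_exp_neg_atTop_nhds_zero.comp
    (Real.tendsto_sum_range_one_div_nat_succ_atTop.const_mul_atTop hr0)).const_mul (eigenVal d a 0)
  simpa [Function.comp_def] using h

/-! ### The operator and its norm -/

lemma one_div_norm_rpow_eq {d : ℕ} (a : ℝ) (ω θ : USphere d) :
    1 / ‖(θ : EucSp d) - (ω : EucSp d)‖ ^ ((d : ℝ) + 2 * a - 2) =
      4 ^ (1 - a - (d : ℝ) / 2) * chordSq ω θ ^ (1 - a - (d : ℝ) / 2) := by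
  have h4 : 0 ≤ 4 * chordSq ω θ := by have := chordSq_nonneg ω θ; positivity
  rw [← Real.mul_rpow (by norm_num) (chordSq_nonneg ω θ),
    show 1 - a - (d : ℝ) / 2 = -(((d : ℝ) + 2 * a - 2) / 2) by ring, Real.rpow_neg h4,
    ← norm_sub_sq_eq_chordSq, ← Real.rpow_natCast, ← Real.rpow_mul (norm_nonneg _), one_div]
  congr 2
  push_cast
  ring

lemma rieszIntegrand_eq {d : ℕ} (a : ℝ) (f : USphere d → ℂ) (ω θ : USphere d) :
    rieszIntegrand d a f ω θ = ((4 ^ (1 - a - (d : ℝ) / 2) : ℝ) : ℂ) *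
      (((chordSq ω θ ^ (1 - a - (d : ℝ) / 2) : ℝ) : ℂ) * f θ) := by
  rw [rieszIntegrand, one_div_norm_rpow_eq, Complex.ofReal_mul, mul_assoc]

lemma half_mul_chordMomentCoeff (d k : ℕ) (a : ℝ) :
    1 / 2 * 4 ^ (1 - a - (d : ℝ) / 2) * chordMomentCoeff d k (1 - a - (d : ℝ) / 2) * (-1) ^ k =
      eigenVal d a k := by
  -- The exponents of `2` are `-1`, `2 - 2a - d` and `d - 1`, with sum `-2a`.
  have e1 : (1 / 2 : ℝ) * 4 ^ (1 - a - (d : ℝ) / 2) * 2 ^ ((d : ℝ) - 1) = (2 ^ (2 * a))⁻¹ := by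
    rw [show (4 : ℝ) = 2 ^ (2 : ℝ) by norm_num, ← Real.rpow_mul zero_le_two,
      show (1 / 2 : ℝ) = 2 ^ (-1 : ℝ) by rw [Real.rpow_neg_one]; norm_num,
      ← Real.rpow_add two_pos, ← Real.rpow_add two_pos, ← Real.rpow_neg zero_le_two]
    congr 1
    ring
  have e2 : ∏ j ∈ Finset.range k, (2 - a - (d : ℝ) / 2 - ((j : ℝ) + 1)) =
      ∏ j ∈ Finset.range k, (1 - a - (d : ℝ) / 2 - j) :=
    Finset.prod_congr rfl fun j _ => by ring
  rw [eigenVal, chordMomentCoeff, chordConst, e2,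
    show 1 - a - (d : ℝ) / 2 + ((d : ℝ) - 1) / 2 = 1 / 2 - a by ring,
    show 1 - a - (d : ℝ) / 2 + ((d : ℝ) - 1) + k = -a + d / 2 + k by ring, div_eq_mul_inv _ (2 ^ _),
    ← e1]
  ring

lemma rieszSphere_solidHarmonic {d : ℕ} (hd : 2 ≤ d) {a : ℝ} (ha₂ : a < 1 / 2) {k : ℕ}
    {P : MvPolynomial (Fin d) ℂ} (hP : IsSolidHarmonic d k P) (ω : USphere d) :
    Integrable (rieszIntegrand d a (sphereRestrict d P) ω) (surfMeasure d) ∧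
      rieszSphere d a (sphereRestrict d P) ω = (eigenVal d a k : ℂ) * sphereRestrict d P ω := by
  have hβ : -(((d : ℝ) - 1) / 2) < 1 - a - (d : ℝ) / 2 := by linarith
  have he : rieszIntegrand d a (sphereRestrict d P) ω = _ := funext (rieszIntegrand_eq a _ ω)
  refine ⟨?_, ?_⟩
  · rw [he]
    exact (integrable_chordSq_rpow_mul hd P ω hβ).const_mul _
  · have hm := chordMoment_eq hd hP ω hβ
    rw [chordMoment] at hm
    rw [rieszSphere, he, integral_const_mul, hm, sphereRestrict_neg hP.1,
      ← half_mul_chordMomentCoeff]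
    push_cast
    ring

lemma exists_rieszSphere_operator {d : ℕ} (hd : 2 ≤ d) {a : ℝ} (ha₁ : 1 - (d : ℝ) / 2 < a)
    (ha₂ : a < 1 / 2) :
    ∃ T : L2Sphere d →L[ℂ] L2Sphere d,
      (∀ f : L2Sphere d, ∀ᵐ ω ∂(surfMeasure d),
        Integrable (rieszIntegrand d a f ω) (surfMeasure d) ∧ T f ω = rieszSphere d a f ω) ∧
      IsCompactOperator T ∧ ‖T‖ ≤ eigenVal d a 0 := by
  have hβ : -(((d : ℝ) - 1) / 2) < 1 - a - (d : ℝ) / 2 := by linarith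
  obtain ⟨T, hTn, hT⟩ := exists_chordSq_rpow_operator hd hβ
  have hc := isCompactOperator_chordSq_rpow hd hβ (by linarith) hT
  set c : ℝ := 1 / 2 * 4 ^ (1 - a - (d : ℝ) / 2) with hcdef
  refine ⟨(c : ℂ) • T, fun f => ?_, hc.smul (c : ℂ), ?_⟩
  · filter_upwards [hT f, Lp.coeFn_smul (c : ℂ) (T f)] with ω hω hs
    have he : rieszIntegrand d a f ω = _ := funext (rieszIntegrand_eq a _ ω)
    rw [he]
    refine ⟨hω.1.const_mul _, ?_⟩
    rw [smul_apply, hs, Pi.smul_apply, hω.2, rieszSphere, he, integral_const_mul, smul_eq_mul,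
      ← mul_assoc, hcdef]
    push_cast
    rfl
  · rw [norm_smul, Complex.norm_real, Real.norm_of_nonneg (by positivity),
      ← half_mul_chordMomentCoeff, pow_zero, mul_one]
    exact mul_le_mul_of_nonneg_left hTn (by positivity)

end

theorem theorem1p6 (d : ℕ) (hd : 2 ≤ d) (a : ℝ) (ha₁ : 1 - (d : ℝ) / 2 < a) (ha₂ : a < 1 / 2) :
    -- `eigenVal` is the Gamma expression, extended continuously across the poles
    (∀ k : ℕ, (∀ m : ℕ, 2 - a - (d : ℝ) / 2 ≠ -(m : ℝ)) → eigenVal d a k = eigenGamma d a k) ∧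
    (∀ k : ℕ, Tendsto (fun b : ℝ => eigenGamma d b k) (𝓝[≠] a) (𝓝 (eigenVal d a k))) ∧
    -- the integral defines a compact operator on `L²`, with its eigenfunctions and its norm
    (∃ T : L2Sphere d →L[ℂ] L2Sphere d,
      (∀ f : L2Sphere d, ∀ᵐ ω ∂(surfMeasure d),
        Integrable (rieszIntegrand d a f ω) (surfMeasure d) ∧ T f ω = rieszSphere d a f ω) ∧
      IsCompactOperator T ∧
      (∀ (k : ℕ) (P : MvPolynomial (Fin d) ℂ), IsSolidHarmonic d k P →
        T (ContinuousMap.toLp 2 (surfMeasure d) ℂ (sphereRestrict d P)) =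
          (eigenVal d a k : ℂ) •
            ContinuousMap.toLp 2 (surfMeasure d) ℂ (sphereRestrict d P)) ∧
      ‖T‖ = Real.pi ^ (((d : ℝ) - 1) / 2) / 2 ^ (2 * a) *
        (Real.Gamma (1 / 2 - a) / Real.Gamma (-a + d / 2))) ∧
    -- the eigenvalue equation holds at every point of the sphere
    (∀ (k : ℕ) (P : MvPolynomial (Fin d) ℂ), IsSolidHarmonic d k P → ∀ ω : USphere d,
      Integrable (rieszIntegrand d a (sphereRestrict d P) ω) (surfMeasure d) ∧
        rieszSphere d a (sphereRestrict d P) ω = (eigenVal d a k : ℂ) * sphereRestrict d P ω) ∧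
    StrictAnti (eigenVal d a) ∧
    Tendsto (eigenVal d a) atTop (𝓝 0) := by

  have hpt := fun (k : ℕ) (P : MvPolynomial (Fin d) ℂ) (hP : IsSolidHarmonic d k P) =>
    rieszSphere_solidHarmonic hd ha₂ hP
  refine ⟨fun k => eigenVal_eq_eigenGamma ha₁ k, tendsto_eigenGamma hd ha₁ ha₂, ?_, hpt,
    strictAnti_eigenVal hd ha₁ ha₂, tendsto_eigenVal hd ha₁ ha₂⟩
  obtain ⟨T, hT, hc, hn⟩ := exists_rieszSphere_operator hd ha₁ ha₂
  have heig (k : ℕ) (P : MvPolynomial (Fin d) ℂ) (hP : IsSolidHarmonic d k P) :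
      T (ContinuousMap.toLp 2 (surfMeasure d) ℂ (sphereRestrict d P)) =
        (eigenVal d a k : ℂ) •
          ContinuousMap.toLp 2 (surfMeasure d) ℂ (sphereRestrict d P) := by
    set p := ContinuousMap.toLp 2 (surfMeasure d) ℂ (sphereRestrict d P)
    have hp := ContinuousMap.coeFn_toLp (surfMeasure d) (𝕜 := ℂ) (p := 2) (sphereRestrict d P)
    ext
    filter_upwards [hT p, hp, Lp.coeFn_smul (eigenVal d a k : ℂ) p] with ω h1 h2 h3
    -- The integral does not see the choice of representative of the `L²` class, so the pointwise
    -- equation applies.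
    rw [h1.2, h3, Pi.smul_apply, h2, smul_eq_mul, ← (hpt k P hP ω).2, rieszSphere, rieszSphere]
    congr 1
    refine integral_congr_ae ?_
    filter_upwards [hp] with θ hθ
    rw [rieszIntegrand, rieszIntegrand, hθ]
  refine ⟨T, hT, hc, heig, ?_⟩
  have h0 : Real.pi ^ (((d : ℝ) - 1) / 2) / 2 ^ (2 * a) *
      (Real.Gamma (1 / 2 - a) / Real.Gamma (-a + d / 2)) = eigenVal d a 0 := by
    simp [eigenVal]
  rw [h0]
  -- Schur's test is sharp here: the constant function `1` is an eigenvector for `λ_0`, which gives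
  -- the reverse inequality.
  refine le_antisymm hn ?_
  have h1 := heig 0 1 (isSolidHarmonic_one d)
  set p := ContinuousMap.toLp 2 (surfMeasure d) ℂ (sphereRestrict d 1) with hp
  have hp0 : p ≠ 0 := by
    intro h
    rw [hp, ← map_zero (ContinuousMap.toLp 2 (surfMeasure d) ℂ)] at h
    have h := ContinuousMap.toLp_injective (surfMeasure d) h
    have h' := DFunLike.congr_fun h
      (⟨EuclideanSpace.single ⟨0, by omega⟩ 1, by simp⟩ : USphere d)
    rw [sphereRestrict_one] at h'
    simp at h'
  have h2 := T.le_opNorm p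
  rw [h1, norm_smul, Complex.norm_real, Real.norm_of_nonneg (eigenVal_pos hd ha₁ ha₂ 0).le] at h2
  exact le_of_mul_le_mul_right h2 (norm_pos_iff.2 hp0)
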